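/- Let $\Omega\subset\mathbb R^d$ be a bounded open set with Lipschitz boundary (near each boundary point, in suitable orthonormal coordinates, $\Omega$ is the region strictly above the graph of a Lipschitz function). Let $\mu$ be a Borel probability measure on $\mathbb R^d$ concentrated on $\Omega$ and absolutely continuous with respect to Lebesgue measure, with density $f$, and let $\nu$ be a Borel probability measure on $\mathbb R^d$. Suppose that the set $\{T\in H^1(\Omega;\mathbb R^d) : T_\#\mu=\nu\}$ is non-empty, where $T_\#\mu$ denotes the image measure of $\mu$ under $T$. Then for every $\varepsilon>0$ the problem $$\inf\left\{\int_\Omega |T(x)-x|\,f(x)\,dx+\varepsilon\int_\Omega |DT(x)|^2\,dx \;:\; T\in H^1(\Omega;\mathbb R^d),\ T_\#\mu=\nu\right\}$$ admits at least one solution, i.e. the infimum is attained by some $T\in H^1(\Omega;\mathbb R^d)$ with $T_\#\mu=\nu$. Here $DT$ is the weak Jacobian matrix of $T$, $|DT|$ is its Euclidean (Frobenius) norm, $|T(x)-x|$ is the Euclidean norm, and the functional takes values in $[0,+\infty]$. -/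

import Mathlib

open MeasureTheory Set Metric
open scoped ENNReal NNReal ContDiff RealInnerProductSpace

/-- `Ω` has Lipschitz boundary: near each of its boundary points `p`, there are an axis (a unit
vector `e`) and a Lipschitz function `γ` of the coordinates orthogonal to `e` such that `Ω`
coincides with the open region lying strictly above the graph of `γ` in the direction `e`. -/
def HasLipschitzBoundary {d : ℕ} (Ω : Set (EuclideanSpace ℝ (Fin d))) : Prop :=
  ∀ p ∈ frontier Ω, ∃ (r : ℝ) (e : EuclideanSpace ℝ (Fin d)) (K : ℝ≥0) (γ : (ℝ ∙ e)ᗮ → ℝ),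
    0 < r ∧ ‖e‖ = 1 ∧ LipschitzWith K γ ∧
      Ω ∩ ball p r = {x | γ ((ℝ ∙ e)ᗮ.orthogonalProjectionOnto x) < ⟪e, x⟫} ∩ ball p r

/-- `g` is the weak partial derivative of the scalar function `u` on `Ω` in the `j`-th coordinate
direction: both are locally integrable on `Ω` and `∫_Ω u ∂ⱼφ = - ∫_Ω g φ` for all `φ ∈ C_c^∞(Ω)`. -/
def IsWeakPartialDeriv {d : ℕ} (Ω : Set (EuclideanSpace ℝ (Fin d)))
    (u : EuclideanSpace ℝ (Fin d) → ℝ) (j : Fin d) (g : EuclideanSpace ℝ (Fin d) → ℝ) : Prop :=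
  LocallyIntegrableOn u Ω ∧ LocallyIntegrableOn g Ω ∧
    ∀ φ : EuclideanSpace ℝ (Fin d) → ℝ, ContDiff ℝ ∞ φ → HasCompactSupport φ → tsupport φ ⊆ Ω →
      ∫ x in Ω, u x * fderiv ℝ φ x (EuclideanSpace.single j 1) = - ∫ x in Ω, g x * φ x

/-- The matrix field `G` is a weak Jacobian of the vector-valued map `T` on `Ω`. -/
def IsWeakJacobian {d : ℕ} (Ω : Set (EuclideanSpace ℝ (Fin d)))
    (T : EuclideanSpace ℝ (Fin d) → EuclideanSpace ℝ (Fin d))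
    (G : EuclideanSpace ℝ (Fin d) → Matrix (Fin d) (Fin d) ℝ) : Prop :=
  ∀ i j, IsWeakPartialDeriv Ω (fun x => T x i) j (fun x => G x i j)

/-- The Sobolev space `H¹(Ω; ℝᵈ)`: maps in `L²(Ω)` with a weak Jacobian in `L²(Ω)`. The values of
`T` outside `Ω` are irrelevant. -/
def MemH1 {d : ℕ} (Ω : Set (EuclideanSpace ℝ (Fin d)))
    (T : EuclideanSpace ℝ (Fin d) → EuclideanSpace ℝ (Fin d)) : Prop :=
  MemLp T 2 (volume.restrict Ω) ∧
    ∃ G : EuclideanSpace ℝ (Fin d) → Matrix (Fin d) (Fin d) ℝ,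
      IsWeakJacobian Ω T G ∧ ∀ i j, MemLp (fun x => G x i j) 2 (volume.restrict Ω)

open Classical in
/-- The weak Jacobian `DT` of `T` on `Ω` (unique almost everywhere on `Ω`, when `Ω` is open), and
`0` if there is none. -/
noncomputable def weakJacobian {d : ℕ} (Ω : Set (EuclideanSpace ℝ (Fin d)))
    (T : EuclideanSpace ℝ (Fin d) → EuclideanSpace ℝ (Fin d)) :
    EuclideanSpace ℝ (Fin d) → Matrix (Fin d) (Fin d) ℝ :=
  if h : ∃ G, IsWeakJacobian Ω T G then h.choose else 0

theorem IsWeakPartialDeriv.ae_eq {d : ℕ} {Ω : Set (EuclideanSpace ℝ (Fin d))} (hΩ : IsOpen Ω)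
    {u : EuclideanSpace ℝ (Fin d) → ℝ} {j : Fin d} {g h : EuclideanSpace ℝ (Fin d) → ℝ}
    (hg : IsWeakPartialDeriv Ω u j g) (hh : IsWeakPartialDeriv Ω u j h) :
    g =ᵐ[volume.restrict Ω] h := by
  have key : ∀ᵐ x ∂volume, x ∈ Ω → (g - h) x = 0 := by
    refine hΩ.ae_eq_zero_of_integral_contDiff_smul_eq_zero (hg.2.1.sub hh.2.1) ?_
    intro φ hφ hc hs
    have hint : ∀ k : EuclideanSpace ℝ (Fin d) → ℝ, LocallyIntegrableOn k Ω →
        Integrable (fun x => k x * φ x) (volume.restrict Ω) := by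
      intro k hk
      have h1 : IntegrableOn (fun x => k x * φ x) (tsupport φ) :=
        (hk.integrableOn_compact_subset hs hc).mul_continuousOn hφ.continuous.continuousOn hc
      refine Integrable.restrict ?_
      refine (integrableOn_iff_integrable_of_support_subset ?_).1 h1
      exact (Function.support_mul_subset_right _ _).trans (subset_tsupport φ)
    have e1 : ∫ x in Ω, g x * φ x = ∫ x in Ω, h x * φ x :=
      neg_injective ((hg.2.2 φ hφ hc hs).symm.trans (hh.2.2 φ hφ hc hs))
    have e2 : ∫ x, φ x • (g - h) x = ∫ x in Ω, φ x • (g - h) x := by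
      refine (setIntegral_eq_integral_of_forall_compl_eq_zero fun x hx => ?_).symm
      rw [image_eq_zero_of_notMem_tsupport fun hx' => hx (hs hx'), zero_smul]
    rw [e2, ← sub_eq_zero.2 e1, ← integral_sub (hint g hg.2.1) (hint h hh.2.1)]
    refine integral_congr_ae (Filter.Eventually.of_forall fun x => ?_)
    simp only [Pi.sub_apply, smul_eq_mul]
    ring
  rw [Filter.EventuallyEq, ae_restrict_iff' hΩ.measurableSet]
  filter_upwards [key] with x hx hxΩ
  exact sub_eq_zero.1 (hx hxΩ)

/-- Any weak Jacobian of `T` on an open set agrees almost everywhere with `weakJacobian Ω T`. -/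
theorem IsWeakJacobian.weakJacobian_ae_eq {d : ℕ} {Ω : Set (EuclideanSpace ℝ (Fin d))}
    (hΩ : IsOpen Ω) {T : EuclideanSpace ℝ (Fin d) → EuclideanSpace ℝ (Fin d)}
    {G : EuclideanSpace ℝ (Fin d) → Matrix (Fin d) (Fin d) ℝ} (hG : IsWeakJacobian Ω T G) :
    weakJacobian Ω T =ᵐ[volume.restrict Ω] G := by
  have hex : ∃ G, IsWeakJacobian Ω T G := ⟨G, hG⟩
  have hw : IsWeakJacobian Ω T (weakJacobian Ω T) := by
    rw [weakJacobian, dif_pos hex]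
    exact hex.choose_spec
  have hall : ∀ᵐ x ∂volume.restrict Ω, ∀ i j, weakJacobian Ω T x i j = G x i j :=
    ae_all_iff.2 fun i => ae_all_iff.2 fun j => (hw i j).ae_eq hΩ (hG i j)
  filter_upwards [hall] with x hx
  exact Matrix.ext hx

/-- The Dirichlet energy `∫_Ω |DT(x)|² dx`, where `|DT|` is the Euclidean (Frobenius) norm. -/
noncomputable def dirichletEnergy {d : ℕ} (Ω : Set (EuclideanSpace ℝ (Fin d)))
    (T : EuclideanSpace ℝ (Fin d) → EuclideanSpace ℝ (Fin d)) : ℝ≥0∞ :=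
  ∫⁻ x in Ω, ∑ i, ∑ j, ENNReal.ofReal ((weakJacobian Ω T x i j) ^ 2)

/-- The penalized transport cost
`J_ε(T) = ∫_Ω |T(x) - x| f(x) dx + ε ∫_Ω |DT(x)|² dx`, with values in `[0, ∞]`. -/
noncomputable def penalizedCost {d : ℕ} (Ω : Set (EuclideanSpace ℝ (Fin d)))
    (f : EuclideanSpace ℝ (Fin d) → ℝ≥0∞) (ε : ℝ)
    (T : EuclideanSpace ℝ (Fin d) → EuclideanSpace ℝ (Fin d)) : ℝ≥0∞ :=
  (∫⁻ x in Ω, ENNReal.ofReal ‖T x - x‖ * f x) + ENNReal.ofReal ε * dirichletEnergy Ω T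

/-- The admissible maps: `T ∈ H¹(Ω; ℝᵈ)` with `T_# μ = ν`. (If `μ` is carried by `Ω` and absolutely
continuous, every `T ∈ H¹(Ω)` is `μ`-a.e. measurable, so `Measure.map` is the image measure.) -/
def sobolevTransportMaps {d : ℕ} (Ω : Set (EuclideanSpace ℝ (Fin d)))
    (μ ν : Measure (EuclideanSpace ℝ (Fin d))) :
    Set (EuclideanSpace ℝ (Fin d) → EuclideanSpace ℝ (Fin d)) :=
  {T | MemH1 Ω T ∧ Measure.map T μ = ν}

/-!
The theorem is proved by the direct method. Along a minimizing sequence `T n` the Dirichlet energies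
are bounded. It remains to find a subsequence which converges almost everywhere for `μ` to a map `S`
in `H¹(Ω)`, with weakly convergent Jacobians. Dominated convergence then gives `S_# μ = ν`
(`map_eq_of_ae_tendsto`), Fatou's lemma handles the transport cost, and weak lower semicontinuity
of the `L²` norm handles the Dirichlet energy.

Everything rests on one estimate, `IsSobolevPair.lintegral_sub_sq_le`: if the segments `[x, x + h]`
with `x ∈ A` stay in `Ω`, then `∫_A |u(x + h) - u(x)|² dx ≤ |h|² ∫ |∇u|²`. It follows from the formula
`u(x + h) - u(x) = ∫₀¹ ∇u(x + τ h) · h dτ` for almost every `x`, itself obtained by duality with test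
functions.

* *Bounds in `L²`.* By the translation estimate, a bound for the sequence in `L²` of a small ball can
  be moved to any nearby ball, so the set `G` of points of `Ω` near which the sequence is bounded is
  relatively clopen. As all the `T n` push `μ` forward to `ν`, which is tight, they are bounded by one
  constant on a definite part of any ball charged by `μ`. Poincaré's inequality on the ball, again a
  consequence of the translation estimate, shows that its centre lies in `G`
  (`isLocallyL2BoundedAt_of_measure_ball_ne_zero`). Hence `μ` does not charge `Ω \ G`, and `T n` may
  be replaced by `0` there. Near a boundary point, translating along the axis of the Lipschitz graph
  pushes `Ω` into a compact subset of itself, which extends the bound up to the boundary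
  (`exists_bound_of_hasLipschitzBoundary`). This is the only use of the regularity of `Ω`.
* *Compactness.* A subsequence converges weakly in `L²` together with its gradients. The averages over
  balls of radius `δ` converge strongly on compact sets, and by the translation estimate they are
  uniformly close to the functions themselves when `δ` is small. So the convergence is strong in `L²`
  of every compact subset of `Ω` (`WeakTendsto.tendsto_lintegral_sq`), and almost everywhere on `Ω`
  along a further subsequence.
-/

variable {d : ℕ}

local notation "𝔼" => EuclideanSpace ℝ (Fin d)

open scoped Topology

/-! ### Sobolev functions extended by zero -/

/-- `u ∈ H¹(Ω)` with weak gradient `g`, both given by measurable representatives on the whole space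
which vanish outside `Ω`. -/
structure IsSobolevPair (Ω : Set 𝔼) (u : 𝔼 → ℝ) (g : Fin d → 𝔼 → ℝ) : Prop where
  measurable : Measurable u
  measurable_grad : ∀ j, Measurable (g j)
  eq_zero : ∀ x ∉ Ω, u x = 0
  grad_eq_zero : ∀ j, ∀ x ∉ Ω, g j x = 0
  memLp : MemLp u 2 volume
  memLp_grad : ∀ j, MemLp (g j) 2 volume
  weak : ∀ j, ∀ φ : 𝔼 → ℝ, ContDiff ℝ ∞ φ → HasCompactSupport φ → tsupport φ ⊆ Ω →
    ∫ x, u x * fderiv ℝ φ x (EuclideanSpace.single j 1) = - ∫ x, g j x * φ x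

theorem integrable_of_memLp_two_of_eq_zero {Ω : Set 𝔼} (hb : Bornology.IsBounded Ω) {u : 𝔼 → ℝ}
    (hu : MemLp u 2 volume) (h0 : ∀ x ∉ Ω, u x = 0) : Integrable u := by
  have h1 : IntegrableOn u (closure Ω) := by
    have : IsFiniteMeasure (volume.restrict (closure Ω)) :=
      ⟨by simpa using hb.isCompact_closure.measure_lt_top⟩
    exact (hu.restrict (closure Ω)).integrable one_le_two
  refine (integrableOn_iff_integrable_of_support_subset fun x hx => ?_).1 h1
  by_contra hc
  exact hx (h0 x fun h => hc (subset_closure h))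

theorem IsSobolevPair.integrable {Ω : Set 𝔼} {u : 𝔼 → ℝ} {g : Fin d → 𝔼 → ℝ}
    (hb : Bornology.IsBounded Ω) (hu : IsSobolevPair Ω u g) : Integrable u :=
  integrable_of_memLp_two_of_eq_zero hb hu.memLp hu.eq_zero

theorem IsSobolevPair.integrable_grad {Ω : Set 𝔼} {u : 𝔼 → ℝ} {g : Fin d → 𝔼 → ℝ}
    (hb : Bornology.IsBounded Ω) (hu : IsSobolevPair Ω u g) (j : Fin d) :
    Integrable (g j) :=
  integrable_of_memLp_two_of_eq_zero hb (hu.memLp_grad j) (hu.grad_eq_zero j)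

theorem integrable_mul_of_continuous_of_hasCompactSupport {α : Type*} [MeasurableSpace α]
    {m : Measure α} {u : α → ℝ} (hu : Integrable u m) {φ : 𝔼 → ℝ} (hφ : Continuous φ)
    (hc : HasCompactSupport φ) {k : α → 𝔼} (hk : Measurable k) :
    Integrable (fun x => u x * φ (k x)) m := by
  obtain ⟨C, hC⟩ := hc.exists_bound_of_continuous hφ
  exact hu.mul_bdd (c := C) (hφ.measurable.comp hk).aestronglyMeasurable
    (Filter.Eventually.of_forall fun x => hC (k x))

/-! ### Differences along segments -/

theorem isOpen_setOf_segment_subset {Ω : Set 𝔼} (hΩ : IsOpen Ω) (h : 𝔼) :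
    IsOpen {x : 𝔼 | ∀ τ ∈ Icc (0 : ℝ) 1, x + τ • h ∈ Ω} := by
  refine isOpen_iff_mem_nhds.2 fun x hx => ?_
  refine isCompact_Icc.eventually_forall_of_forall_eventually
    (P := fun y (τ : ℝ) => y + τ • h ∈ Ω) fun τ hτ => ?_
  have : Continuous fun z : 𝔼 × ℝ => z.1 + z.2 • h := by fun_prop
  exact this.continuousAt.eventually (hΩ.mem_nhds (hx τ hτ))

theorem fderiv_apply_eq_sum (φ : 𝔼 → ℝ) (x h : 𝔼) :
    fderiv ℝ φ x h = ∑ j, h j * fderiv ℝ φ x (EuclideanSpace.single j 1) := by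
  conv_lhs => rw [← (EuclideanSpace.basisFun (Fin d) ℝ).sum_repr h]
  simp

theorem measurePreserving_shear (m : Measure ℝ) [SFinite m] (h : 𝔼) :
    MeasurePreserving (fun p : ℝ × 𝔼 => (p.1, p.2 + p.1 • h)) (m.prod volume) (m.prod volume) :=
  (MeasurePreserving.id m).skew_product (g := fun τ x => x + τ • h) (by fun_prop)
    (Filter.Eventually.of_forall fun τ => (measurePreserving_add_right volume (τ • h)).map_eq)

theorem IsSobolevPair.integral_mul_fderiv {Ω : Set 𝔼} {u : 𝔼 → ℝ} {g : Fin d → 𝔼 → ℝ}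
    (hb : Bornology.IsBounded Ω) (hu : IsSobolevPair Ω u g) {φ : 𝔼 → ℝ}
    (hφ : ContDiff ℝ ∞ φ) (hc : HasCompactSupport φ) (hs : tsupport φ ⊆ Ω) (h : 𝔼) :
    ∫ x, u x * fderiv ℝ φ x h = - ∫ x, (∑ j, h j * g j x) * φ x := by
  have hd : ∀ v : 𝔼, Integrable fun x => u x * fderiv ℝ φ x v := fun v =>
    integrable_mul_of_continuous_of_hasCompactSupport (hu.integrable hb)
      (φ := fun x => fderiv ℝ φ x v)
      ((hφ.continuous_fderiv (by simp)).clm_apply continuous_const)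
      ((hc.fderiv (𝕜 := ℝ)).comp_left (g := fun L : 𝔼 →L[ℝ] ℝ => L v) rfl) measurable_id
  have hg : ∀ j, Integrable fun x => g j x * φ x := fun j =>
    integrable_mul_of_continuous_of_hasCompactSupport (hu.integrable_grad hb j)
      hφ.continuous hc measurable_id
  simp_rw [fderiv_apply_eq_sum φ _ h, Finset.mul_sum, Finset.sum_mul]
  rw [integral_finsetSum _ fun j _ => ?_, integral_finsetSum _ fun j _ => ?_,
    ← Finset.sum_neg_distrib]
  · refine Finset.sum_congr rfl fun j _ => ?_
    have e := hu.weak j φ hφ hc hs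
    calc _ = h j * ∫ x, u x * fderiv ℝ φ x (EuclideanSpace.single j 1) := by
          rw [← integral_const_mul]; congr 1; ext x; ring
      _ = _ := by rw [e, mul_neg, ← integral_const_mul]; congr 2; ext x; ring
  · simpa only [mul_assoc] using (hg j).const_mul (h j)
  · simpa only [mul_left_comm] using (hd (EuclideanSpace.single j 1)).const_mul (h j)

/-- The fundamental theorem of calculus along a translation: it is proved by testing against smooth
functions supported in the set of those `x` whose segment `[x, x + h]` stays in `Ω`, whose
translates by `τ h` are admissible in the definition of the weak derivative. -/
theorem IsSobolevPair.ae_sub_eq_integral {Ω : Set 𝔼} {u : 𝔼 → ℝ} {g : Fin d → 𝔼 → ℝ}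
    (hΩ : IsOpen Ω) (hb : Bornology.IsBounded Ω) (hu : IsSobolevPair Ω u g)
    (h : 𝔼) : ∀ᵐ x, (∀ τ ∈ Icc (0 : ℝ) 1, x + τ • h ∈ Ω) →
      u (x + h) - u x = ∫ τ in Ioc (0 : ℝ) 1, ∑ j, h j * g j (x + τ • h) := by
  set m : Measure ℝ := volume.restrict (Ioc (0 : ℝ) 1) with hm
  set G : 𝔼 → ℝ := fun x => ∑ j, h j * g j x with hG
  have hGi : Integrable G := integrable_finsetSum _ fun j _ => (hu.integrable_grad hb j).const_mul _
  have hui := hu.integrable hb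
  have hF : Integrable (fun p : ℝ × 𝔼 => G (p.2 + p.1 • h)) (m.prod volume) :=
    (measurePreserving_shear m h).integrable_comp_of_integrable (hGi.comp_snd m)
  have hV : Integrable fun x => u (x + h) - u x - ∫ τ, G (x + τ • h) ∂m :=
    ((hui.comp_add_right h).sub hui).sub hF.integral_prod_right
  have key := (isOpen_setOf_segment_subset hΩ h).ae_eq_zero_of_integral_contDiff_smul_eq_zero
    (hV.locallyIntegrable.locallyIntegrableOn _) (μ := volume) ?_
  · filter_upwards [key] with x hx hx'
    exact sub_eq_zero.1 (hx hx')
  intro φ hφ hc hs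
  have hdφ : Continuous fun x => fderiv ℝ φ x h :=
    (hφ.continuous_fderiv (by simp)).clm_apply continuous_const
  have hdc : HasCompactSupport fun x => fderiv ℝ φ x h :=
    (hc.fderiv (𝕜 := ℝ)).comp_left (g := fun L : 𝔼 →L[ℝ] ℝ => L h) rfl
  -- the definition of the weak derivative, for the translates of `φ`
  have step1 : ∀ τ ∈ Ioc (0 : ℝ) 1,
      ∫ x, G (x + τ • h) * φ x = - ∫ x, u x * fderiv ℝ φ (x - τ • h) h := by
    intro τ hτ
    have hψ : ContDiff ℝ ∞ fun x => φ (x - τ • h) := hφ.comp (contDiff_id.sub contDiff_const)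
    have hψc : HasCompactSupport fun x => φ (x - τ • h) :=
      hc.comp_homeomorph (Homeomorph.subRight (τ • h))
    have hψs : tsupport (fun x => φ (x - τ • h)) ⊆ Ω := by
      have : tsupport (fun x => φ (x - τ • h)) ⊆ (fun x => x - τ • h) ⁻¹' tsupport φ :=
        closure_minimal (fun x hx => subset_tsupport φ hx)
          ((isClosed_tsupport φ).preimage (by fun_prop))
      intro x hx
      simpa using hs (this hx) τ ⟨hτ.1.le, hτ.2⟩
    have e := hu.integral_mul_fderiv hb hψ hψc hψs h
    simp_rw [sub_eq_add_neg, fderiv_comp_add_right, ← sub_eq_add_neg] at e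
    rw [e, neg_neg,
      ← integral_add_right_eq_self (fun x => (∑ j, h j * g j x) * φ (x - τ • h)) (τ • h)]
    simp [hG]
  have hi1 : Integrable (fun p : ℝ × 𝔼 => G (p.2 + p.1 • h) * φ p.2) (m.prod volume) :=
    integrable_mul_of_continuous_of_hasCompactSupport hF hφ.continuous hc measurable_snd
  have hi2 : Integrable (fun p : ℝ × 𝔼 => u p.2 * fderiv ℝ φ (p.2 - p.1 • h) h) (m.prod volume) :=
    integrable_mul_of_continuous_of_hasCompactSupport (hui.comp_snd m) hdφ hdc
      (k := fun p : ℝ × 𝔼 => p.2 - p.1 • h) (by fun_prop)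
  have step2 : ∫ x, (∫ τ, G (x + τ • h) ∂m) * φ x = - ∫ x, u x * (φ x - φ (x - h)) := by
    calc ∫ x, (∫ τ, G (x + τ • h) ∂m) * φ x
        = ∫ x, ∫ τ, G (x + τ • h) * φ x ∂m := by simp_rw [integral_mul_const]
      _ = ∫ τ, (∫ x, G (x + τ • h) * φ x) ∂m := (integral_integral_swap hi1).symm
      _ = ∫ τ, (- ∫ x, u x * fderiv ℝ φ (x - τ • h) h) ∂m :=
          setIntegral_congr_fun measurableSet_Ioc step1
      _ = - ∫ x, ∫ τ, u x * fderiv ℝ φ (x - τ • h) h ∂m := by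
          rw [integral_neg, integral_integral_swap hi2]
      _ = - ∫ x, u x * (φ x - φ (x - h)) := by
          congr 2
          ext x
          rw [integral_const_mul, hm, ← intervalIntegral.integral_of_le zero_le_one]
          congr 1
          have hder : ∀ τ ∈ uIcc (0 : ℝ) 1, HasDerivAt (fun τ : ℝ => - φ (x - τ • h))
              (fderiv ℝ φ (x - τ • h) h) τ := by
            intro τ _
            have h1 : HasDerivAt (fun τ : ℝ => x - τ • h) (-h) τ := by
              simpa using ((hasDerivAt_id τ).smul_const h).const_sub x
            have h2 := ((hφ.differentiable (by simp)) (x - τ • h)).hasFDerivAt.comp_hasDerivAt τ h1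
            simpa [Function.comp_def, Pi.neg_def] using h2.neg
          rw [intervalIntegral.integral_eq_sub_of_hasDerivAt hder]
          · simp [sub_eq_add_neg, add_comm]
          · exact (hdφ.comp (by fun_prop : Continuous fun τ : ℝ => x - τ • h)).intervalIntegrable _ _
  have i1 : Integrable fun x => u (x + h) * φ x :=
    integrable_mul_of_continuous_of_hasCompactSupport (hui.comp_add_right h) hφ.continuous hc
      measurable_id
  have i2 : Integrable fun x => u x * φ x :=
    integrable_mul_of_continuous_of_hasCompactSupport hui hφ.continuous hc measurable_id
  have i3 : Integrable fun x => (∫ τ, G (x + τ • h) ∂m) * φ x :=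
    integrable_mul_of_continuous_of_hasCompactSupport hF.integral_prod_right hφ.continuous hc
      measurable_id
  have i4 : Integrable fun x => u x * φ (x - h) :=
    integrable_mul_of_continuous_of_hasCompactSupport hui hφ.continuous hc
      (k := fun x => x - h) (by fun_prop)
  have step3 : ∫ x, u (x + h) * φ x = ∫ x, u x * φ (x - h) := by
    rw [← integral_add_right_eq_self (fun x => u x * φ (x - h)) h]
    simp
  calc ∫ x, φ x • (u (x + h) - u x - ∫ τ, G (x + τ • h) ∂m)
      = ∫ x, (u (x + h) * φ x - u x * φ x - (∫ τ, G (x + τ • h) ∂m) * φ x) := by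
        congr 1; ext x; simp only [smul_eq_mul]; ring
    _ = 0 := by
        rw [integral_sub (f := fun x => u (x + h) * φ x - u x * φ x) (i1.sub i2) i3,
          integral_sub i1 i2, step2, step3]
        simp_rw [mul_sub]
        rw [integral_sub i2 i4]
        ring

/-! ### The translation estimate -/

/-- The Cauchy–Schwarz inequality against the constant function `1`. -/
theorem sq_lintegral_le {α : Type*} [MeasurableSpace α] {m : Measure α} {F : α → ℝ≥0∞}
    (hF : AEMeasurable F m) : (∫⁻ x, F x ∂m) ^ 2 ≤ m univ * ∫⁻ x, F x ^ 2 ∂m := by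
  have h := ENNReal.lintegral_mul_le_Lp_mul_Lq m Real.HolderConjugate.two_two
    (f := fun _ => 1) aemeasurable_const hF
  simp only [Pi.mul_apply, one_mul, ENNReal.one_rpow, lintegral_const] at h
  calc (∫⁻ x, F x ∂m) ^ 2
      ≤ ((m univ) ^ (1 / 2 : ℝ) * (∫⁻ x, F x ^ (2 : ℝ) ∂m) ^ (1 / 2 : ℝ)) ^ 2 := by gcongr
    _ = _ := by
      rw [mul_pow, ← ENNReal.rpow_natCast, ← ENNReal.rpow_mul, ← ENNReal.rpow_natCast,
        ← ENNReal.rpow_mul]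
      norm_num

theorem enorm_sq_eq_ofReal_sq (x : ℝ) : ‖x‖ₑ ^ 2 = ENNReal.ofReal (x ^ 2) := by
  rw [← ofReal_norm, ← ENNReal.ofReal_pow (norm_nonneg _), Real.norm_eq_abs, sq_abs]

theorem enorm_sum_mul_sq_le (h : 𝔼) (a : Fin d → ℝ) :
    ‖∑ j, h j * a j‖ₑ ^ 2 ≤ ‖h‖ₑ ^ 2 * ∑ j, ‖a j‖ₑ ^ 2 := by
  rw [← ofReal_norm h, ← ENNReal.ofReal_pow (norm_nonneg _), EuclideanSpace.real_norm_sq_eq]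
  simp_rw [enorm_sq_eq_ofReal_sq]
  rw [← ENNReal.ofReal_sum_of_nonneg fun j _ => sq_nonneg _, ← ENNReal.ofReal_mul (by positivity)]
  exact ENNReal.ofReal_le_ofReal (Finset.sum_mul_sq_le_sq_mul_sq _ _ _)

/-- The Dirichlet energy `∫ |g|²` of a scalar function with gradient `g`. -/
noncomputable def gradEnergy (g : Fin d → 𝔼 → ℝ) : ℝ≥0∞ := ∫⁻ x, ∑ j, ‖g j x‖ₑ ^ 2

/-- The translation estimate `‖u(· + h) - u‖ ≤ |h| ‖∇u‖` in `L²(A)`, where the segments `[x, x + h]`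
with `x ∈ A` stay in `Ω`. The set `A` need not be measurable. -/
theorem IsSobolevPair.lintegral_sub_sq_le {Ω : Set 𝔼} {u : 𝔼 → ℝ} {g : Fin d → 𝔼 → ℝ}
    (hΩ : IsOpen Ω) (hb : Bornology.IsBounded Ω) (hu : IsSobolevPair Ω u g) {h : 𝔼} {A : Set 𝔼}
    (hA : ∀ x ∈ A, ∀ τ ∈ Icc (0 : ℝ) 1, x + τ • h ∈ Ω) :
    ∫⁻ x in A, ‖u (x + h) - u x‖ₑ ^ 2 ≤ ‖h‖ₑ ^ 2 * gradEnergy g := by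
  set m : Measure ℝ := volume.restrict (Ioc (0 : ℝ) 1) with hm
  set U : Set 𝔼 := {x : 𝔼 | ∀ τ ∈ Icc (0 : ℝ) 1, x + τ • h ∈ Ω} with hU
  have hUo : IsOpen U := isOpen_setOf_segment_subset hΩ h
  have hgm := hu.measurable_grad
  have hpm : Measurable fun p : 𝔼 × ℝ => ∑ j, ‖g j (p.1 + p.2 • h)‖ₑ ^ 2 :=
    Finset.measurable_sum _ fun j _ => (((hgm j).comp (by fun_prop)).enorm.pow_const 2)
  have hbound : ∀ᵐ x ∂volume.restrict U,
      ‖u (x + h) - u x‖ₑ ^ 2 ≤ ∫⁻ τ, ‖h‖ₑ ^ 2 * ∑ j, ‖g j (x + τ • h)‖ₑ ^ 2 ∂m := by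
    rw [ae_restrict_iff' hUo.measurableSet]
    filter_upwards [hu.ae_sub_eq_integral hΩ hb h] with x hx hxU
    rw [hx hxU]
    calc ‖∫ τ, ∑ j, h j * g j (x + τ • h) ∂m‖ₑ ^ 2
        ≤ (∫⁻ τ, ‖∑ j, h j * g j (x + τ • h)‖ₑ ∂m) ^ 2 := by
          gcongr; exact enorm_integral_le_lintegral_enorm _
      _ ≤ m univ * ∫⁻ τ, ‖∑ j, h j * g j (x + τ • h)‖ₑ ^ 2 ∂m := by
          refine sq_lintegral_le (Measurable.aemeasurable ?_)
          exact (Finset.measurable_sum _ fun j _ =>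
            ((hgm j).comp (by fun_prop)).const_mul (h j)).enorm
      _ ≤ _ := by
          simp only [hm, Measure.restrict_apply_univ, Real.volume_Ioc, sub_zero,
            ENNReal.ofReal_one, one_mul]
          exact lintegral_mono fun τ => enorm_sum_mul_sq_le _ _
  calc ∫⁻ x in A, ‖u (x + h) - u x‖ₑ ^ 2
      ≤ ∫⁻ x in U, ‖u (x + h) - u x‖ₑ ^ 2 := lintegral_mono_set fun x hx => hA x hx
    _ ≤ ∫⁻ x in U, ∫⁻ τ, ‖h‖ₑ ^ 2 * ∑ j, ‖g j (x + τ • h)‖ₑ ^ 2 ∂m := lintegral_mono_ae hbound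
    _ ≤ ∫⁻ x, ∫⁻ τ, ‖h‖ₑ ^ 2 * ∑ j, ‖g j (x + τ • h)‖ₑ ^ 2 ∂m := setLIntegral_le_lintegral _ _
    _ = ∫⁻ τ, (∫⁻ x : 𝔼, ‖h‖ₑ ^ 2 * ∑ j, ‖g j (x + τ • h)‖ₑ ^ 2) ∂m :=
        lintegral_lintegral_swap (hpm.const_mul _).aemeasurable
    _ = ∫⁻ _ : ℝ, ‖h‖ₑ ^ 2 * gradEnergy g ∂m := by
        refine lintegral_congr fun τ => ?_
        rw [lintegral_const_mul' _ _ (by finiteness), gradEnergy,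
          ← lintegral_add_right_eq_self (fun x => ∑ j, ‖g j x‖ₑ ^ 2) (τ • h)]
    _ = _ := by simp [hm]

/-! ### Moving bounds along translations -/

theorem enorm_sq_le_two_mul (a b : ℝ) : ‖a‖ₑ ^ 2 ≤ 2 * (‖b‖ₑ ^ 2 + ‖b - a‖ₑ ^ 2) := by
  calc ‖a‖ₑ ^ 2 = ‖b - (b - a)‖ₑ ^ 2 := by rw [sub_sub_cancel]
    _ ≤ (‖b‖ₑ + ‖b - a‖ₑ) ^ 2 := by gcongr; exact enorm_sub_le
    _ ≤ _ := by
        simp only [enorm_eq_nnnorm]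
        exact_mod_cast add_sq_le (R := ℝ≥0)

theorem IsSobolevPair.lintegral_sq_le_of_translate {Ω : Set 𝔼} {u : 𝔼 → ℝ} {g : Fin d → 𝔼 → ℝ}
    (hΩ : IsOpen Ω) (hb : Bornology.IsBounded Ω) (hu : IsSobolevPair Ω u g) {h : 𝔼} {A B : Set 𝔼}
    (hA : ∀ x ∈ A, ∀ τ ∈ Icc (0 : ℝ) 1, x + τ • h ∈ Ω) (hAB : ∀ x ∈ A, x + h ∈ B) :
    ∫⁻ x in A, ‖u x‖ₑ ^ 2 ≤ 2 * ((∫⁻ x in B, ‖u x‖ₑ ^ 2) + ‖h‖ₑ ^ 2 * gradEnergy g) := by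
  have hm := hu.measurable
  have h1 : ∫⁻ x in A, ‖u (x + h)‖ₑ ^ 2 ≤ ∫⁻ x in B, ‖u x‖ₑ ^ 2 := by
    calc _ ≤ ∫⁻ x in (fun x => x + h) ⁻¹' B, ‖u (x + h)‖ₑ ^ 2 := lintegral_mono_set hAB
      _ = _ := (measurePreserving_add_right volume h).setLIntegral_comp_preimage_emb
          (MeasurableEquiv.addRight h).measurableEmbedding (fun x => ‖u x‖ₑ ^ 2) B
  calc ∫⁻ x in A, ‖u x‖ₑ ^ 2
      ≤ ∫⁻ x in A, 2 * (‖u (x + h)‖ₑ ^ 2 + ‖u (x + h) - u x‖ₑ ^ 2) :=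
        lintegral_mono fun x => enorm_sq_le_two_mul _ _
    _ = 2 * ((∫⁻ x in A, ‖u (x + h)‖ₑ ^ 2) + ∫⁻ x in A, ‖u (x + h) - u x‖ₑ ^ 2) := by
        rw [lintegral_const_mul' _ _ (by finiteness), lintegral_add_left]
        exact (hm.comp (by fun_prop)).enorm.pow_const 2
    _ ≤ _ := by
        gcongr
        exact hu.lintegral_sub_sq_le hΩ hb hA

/-- Poincaré's inequality on a ball, for the double integral of the differences. -/
theorem IsSobolevPair.lintegral_lintegral_ball_sub_sq_le {Ω : Set 𝔼} {u : 𝔼 → ℝ}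
    {g : Fin d → 𝔼 → ℝ} (hΩ : IsOpen Ω) (hb : Bornology.IsBounded Ω) (hu : IsSobolevPair Ω u g)
    {x₀ : 𝔼} {r : ℝ} (hr : ball x₀ r ⊆ Ω) :
    ∫⁻ x in ball x₀ r, ∫⁻ y in ball x₀ r, ‖u y - u x‖ₑ ^ 2 ≤
      volume (ball (0 : 𝔼) (2 * r)) * (ENNReal.ofReal (2 * r) ^ 2 * gradEnergy g) := by
  have hm := hu.measurable
  set B := ball x₀ r with hB
  have hBm : MeasurableSet B := measurableSet_ball
  set F : 𝔼 → 𝔼 → ℝ≥0∞ := fun x h =>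
    B.indicator 1 x * (B.indicator 1 (x + h) * ‖u (x + h) - u x‖ₑ ^ 2) with hF
  have hFm : Measurable (Function.uncurry F) := by
    have h1 : Measurable (B.indicator (1 : 𝔼 → ℝ≥0∞)) := measurable_one.indicator hBm
    refine (h1.comp measurable_fst).mul ((h1.comp (by fun_prop)).mul
      (Measurable.pow_const (Measurable.enorm ?_) 2))
    exact (hm.comp (by fun_prop)).sub (hm.comp measurable_fst)
  have e1 : ∫⁻ x in B, ∫⁻ y in B, ‖u y - u x‖ₑ ^ 2 = ∫⁻ x, ∫⁻ h, F x h := by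
    rw [← lintegral_indicator hBm]
    refine lintegral_congr fun x => ?_
    by_cases hx : x ∈ B
    · rw [indicator_of_mem hx, ← lintegral_indicator hBm,
        ← lintegral_add_left_eq_self (fun y => B.indicator (fun y => ‖u y - u x‖ₑ ^ 2) y) x]
      refine lintegral_congr fun h => ?_
      by_cases hh : x + h ∈ B <;> simp [hF, hx, hh]
    · simp [hF, hx]
  rw [e1, lintegral_lintegral_swap hFm.aemeasurable]
  calc ∫⁻ h, ∫⁻ x, F x h
      ≤ ∫⁻ h, (ball (0 : 𝔼) (2 * r)).indicator
          (fun _ => ENNReal.ofReal (2 * r) ^ 2 * gradEnergy g) h := by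
        refine lintegral_mono fun h => ?_
        by_cases hh : h ∈ ball (0 : 𝔼) (2 * r)
        · rw [indicator_of_mem hh]
          set A : Set 𝔼 := {x | x ∈ B ∧ x + h ∈ B} with hA
          have hAm : MeasurableSet A := hBm.inter (hBm.preimage (by fun_prop))
          have hseg : ∀ x ∈ A, ∀ τ ∈ Icc (0 : ℝ) 1, x + τ • h ∈ Ω := fun x hx τ hτ =>
            hr (by simpa only [add_sub_cancel_left] using (convex_ball x₀ r).add_smul_sub_mem hx.1 hx.2 hτ)
          calc ∫⁻ x, F x h = ∫⁻ x in A, ‖u (x + h) - u x‖ₑ ^ 2 := by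
                rw [← lintegral_indicator hAm]
                refine lintegral_congr fun x => ?_
                by_cases h1 : x ∈ B <;> by_cases h2 : x + h ∈ B <;> simp [hF, hA, h1, h2]
            _ ≤ ‖h‖ₑ ^ 2 * gradEnergy g := hu.lintegral_sub_sq_le hΩ hb hseg
            _ ≤ _ := by
                gcongr
                rw [← ofReal_norm]
                exact ENNReal.ofReal_le_ofReal (mem_ball_zero_iff.1 hh).le
        · have : ∀ x, F x h = 0 := fun x => by
            by_cases h1 : x ∈ B
            · have h2 : x + h ∉ B := fun h2 => hh <| by
                rw [hB, mem_ball] at h1 h2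
                rw [mem_ball_zero_iff]
                calc ‖h‖ = dist (x + h) x := by simp
                  _ ≤ dist (x + h) x₀ + dist x x₀ := dist_triangle_right _ _ _
                  _ < 2 * r := by linarith
              simp [hF, h2]
            · simp [hF, h1]
          simp [this]
    _ = _ := by
        rw [lintegral_indicator measurableSet_ball, lintegral_const, mul_comm]
        simp

/-- On a ball inside `Ω`, the `L²` norm is controlled by the gradient as soon as the function is
bounded by a given constant on a subset of given positive measure. -/
theorem IsSobolevPair.mul_lintegral_ball_sq_le {Ω : Set 𝔼} {u : 𝔼 → ℝ} {g : Fin d → 𝔼 → ℝ}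
    (hΩ : IsOpen Ω) (hb : Bornology.IsBounded Ω) (hu : IsSobolevPair Ω u g)
    {x₀ : 𝔼} {r : ℝ} (hr : ball x₀ r ⊆ Ω) {S : Set 𝔼} (hSm : MeasurableSet S)
    (hS : S ⊆ ball x₀ r) {M : ℝ≥0} (hM : ∀ y ∈ S, ‖u y‖ₑ ≤ M) :
    volume S * ∫⁻ x in ball x₀ r, ‖u x‖ₑ ^ 2 ≤
      2 * (M ^ 2 * volume (ball x₀ r) * volume (ball x₀ r) +
        volume (ball (0 : 𝔼) (2 * r)) * (ENNReal.ofReal (2 * r) ^ 2 * gradEnergy g)) := by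
  have hm := hu.measurable
  have hx : ∀ x, volume S * ‖u x‖ₑ ^ 2 ≤
      2 * (M ^ 2 * volume (ball x₀ r) + ∫⁻ y in ball x₀ r, ‖u y - u x‖ₑ ^ 2) := fun x => by
    calc volume S * ‖u x‖ₑ ^ 2 = ∫⁻ y in S, ‖u x‖ₑ ^ 2 := by simp [mul_comm]
      _ ≤ ∫⁻ y in S, 2 * (M ^ 2 + ‖u y - u x‖ₑ ^ 2) := by
          refine setLIntegral_mono' hSm fun y hy => (enorm_sq_le_two_mul _ (u y)).trans ?_
          gcongr
          exact hM y hy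
      _ ≤ ∫⁻ y in ball x₀ r, 2 * (M ^ 2 + ‖u y - u x‖ₑ ^ 2) := lintegral_mono_set hS
      _ = _ := by
          rw [lintegral_const_mul' _ _ (by finiteness), lintegral_add_left measurable_const]
          simp
  calc volume S * ∫⁻ x in ball x₀ r, ‖u x‖ₑ ^ 2
      = ∫⁻ x in ball x₀ r, volume S * ‖u x‖ₑ ^ 2 :=
        (lintegral_const_mul _ (hm.enorm.pow_const 2)).symm
    _ ≤ ∫⁻ x in ball x₀ r,
          2 * (M ^ 2 * volume (ball x₀ r) + ∫⁻ y in ball x₀ r, ‖u y - u x‖ₑ ^ 2) :=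
        lintegral_mono hx
    _ = 2 * (M ^ 2 * volume (ball x₀ r) * volume (ball x₀ r) +
          ∫⁻ x in ball x₀ r, ∫⁻ y in ball x₀ r, ‖u y - u x‖ₑ ^ 2) := by
        rw [lintegral_const_mul' _ _ (by finiteness), lintegral_add_left measurable_const]
        simp
    _ ≤ _ := by
        gcongr
        exact hu.lintegral_lintegral_ball_sub_sq_le hΩ hb hr

/-! ### Local square-integral bounds for a family -/

/-- The functions `u k` are bounded in `L²(V ∩ Ω)`, uniformly in `k`, for some neighbourhood `V`
of `x`. -/
def IsLocallyL2BoundedAt {κ : Type*} (Ω : Set 𝔼) (u : κ → 𝔼 → ℝ) (x : 𝔼) : Prop :=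
  ∃ V ∈ 𝓝 x, ∃ C : ℝ≥0, ∀ k, ∫⁻ y in V ∩ Ω, ‖u k y‖ₑ ^ 2 ≤ C

theorem isOpen_setOf_isLocallyL2BoundedAt {κ : Type*} (Ω : Set 𝔼) (u : κ → 𝔼 → ℝ) :
    IsOpen {x | IsLocallyL2BoundedAt Ω u x} := by
  refine isOpen_iff_mem_nhds.2 fun x ⟨V, hV, C, hC⟩ => ?_
  filter_upwards [eventually_mem_nhds_iff.2 hV] with y hy
  exact ⟨V, hy, C, hC⟩

theorem exists_bound_of_isCompact {κ : Type*} {Ω : Set 𝔼} {u : κ → 𝔼 → ℝ} {K : Set 𝔼}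
    (hK : IsCompact K) (h : ∀ x ∈ K, IsLocallyL2BoundedAt Ω u x) :
    ∃ C : ℝ≥0, ∀ k, ∫⁻ y in K ∩ Ω, ‖u k y‖ₑ ^ 2 ≤ C := by
  refine hK.induction_on (p := fun s => ∃ C : ℝ≥0, ∀ k, ∫⁻ y in s ∩ Ω, ‖u k y‖ₑ ^ 2 ≤ C)
    ⟨0, by simp⟩ ?_ ?_ ?_
  · rintro s t hst ⟨C, hC⟩
    exact ⟨C, fun k => (lintegral_mono_set (by gcongr)).trans (hC k)⟩
  · rintro s t ⟨C, hC⟩ ⟨C', hC'⟩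
    refine ⟨C + C', fun k => ?_⟩
    rw [union_inter_distrib_right, ENNReal.coe_add]
    exact (lintegral_union_le _ _ _).trans (add_le_add (hC k) (hC' k))
  · intro x hx
    obtain ⟨V, hV, C, hC⟩ := h x hx
    exact ⟨V, mem_nhdsWithin_of_mem_nhds hV, C, hC⟩

/-- The family is bounded near `x` when a neighbourhood of `x` can be moved along a segment inside
`Ω` into a set `B` on which it is bounded. -/
theorem isLocallyL2BoundedAt_of_translate {κ : Type*} {Ω : Set 𝔼} {u : κ → 𝔼 → ℝ}
    {g : κ → Fin d → 𝔼 → ℝ} (hΩ : IsOpen Ω) (hb : Bornology.IsBounded Ω)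
    (hu : ∀ k, IsSobolevPair Ω (u k) (g k)) {D : ℝ≥0} (hD : ∀ k, gradEnergy (g k) ≤ D)
    {x h : 𝔼} {V B : Set 𝔼} (hV : V ∈ 𝓝 x)
    (hseg : ∀ y ∈ V ∩ Ω, ∀ τ ∈ Icc (0 : ℝ) 1, y + τ • h ∈ Ω) (hB : ∀ y ∈ V ∩ Ω, y + h ∈ B)
    {C : ℝ≥0} (hC : ∀ k, ∫⁻ y in B, ‖u k y‖ₑ ^ 2 ≤ C) : IsLocallyL2BoundedAt Ω u x := by
  refine ⟨V, hV, 2 * (C + ‖h‖₊ ^ 2 * D), fun k => ?_⟩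
  refine ((hu k).lintegral_sq_le_of_translate hΩ hb hseg hB).trans ?_
  push_cast
  gcongr
  · exact hC k
  · rfl
  · exact hD k

theorem isLocallyL2BoundedAt_of_mem_ball {κ : Type*} {Ω : Set 𝔼} {u : κ → 𝔼 → ℝ}
    {g : κ → Fin d → 𝔼 → ℝ} (hΩ : IsOpen Ω) (hb : Bornology.IsBounded Ω)
    (hu : ∀ k, IsSobolevPair Ω (u k) (g k)) {D : ℝ≥0} (hD : ∀ k, gradEnergy (g k) ≤ D)
    {x y : 𝔼} {r : ℝ} (hr : ball x (2 * r) ⊆ Ω) (hy : y ∈ ball x r)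
    (hgood : IsLocallyL2BoundedAt Ω u y) : IsLocallyL2BoundedAt Ω u x := by
  obtain ⟨V, hV, C, hC⟩ := hgood
  obtain ⟨s, hs, hsV⟩ := Metric.mem_nhds_iff.1 hV
  have hr0 : 0 < r := dist_nonneg.trans_lt hy
  have hseg : ∀ z ∈ ball x (min r s), ∀ τ ∈ Icc (0 : ℝ) 1, z + τ • (y - x) ∈ Ω := by
    intro z hz τ hτ
    refine hr ?_
    rw [mem_ball, dist_eq_norm] at hz hy ⊢
    calc ‖z + τ • (y - x) - x‖ = ‖(z - x) + τ • (y - x)‖ := by congr 1; abel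
      _ ≤ ‖z - x‖ + ‖τ • (y - x)‖ := norm_add_le _ _
      _ ≤ ‖z - x‖ + 1 * ‖y - x‖ := by
          rw [norm_smul, Real.norm_of_nonneg hτ.1]
          gcongr
          exact hτ.2
      _ < 2 * r := by linarith [lt_min_iff.1 hz]
  refine isLocallyL2BoundedAt_of_translate hΩ hb hu hD (h := y - x) (B := V ∩ Ω)
    (ball_mem_nhds x (lt_min hr0 hs)) (fun z hz => hseg z hz.1) (fun z hz => ⟨hsV ?_, ?_⟩) hC
  · have := hz.1
    rw [mem_ball, dist_eq_norm] at this ⊢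
    rw [show z + (y - x) - y = z - x by abel]
    exact this.trans_le (min_le_right _ _)
  · simpa using hseg z hz.1 1 (by simp)

/-- The region where the family is locally bounded is relatively closed in `Ω`. -/
theorem isOpen_setOf_not_isLocallyL2BoundedAt {κ : Type*} {Ω : Set 𝔼} {u : κ → 𝔼 → ℝ}
    {g : κ → Fin d → 𝔼 → ℝ} (hΩ : IsOpen Ω) (hb : Bornology.IsBounded Ω)
    (hu : ∀ k, IsSobolevPair Ω (u k) (g k)) {D : ℝ≥0} (hD : ∀ k, gradEnergy (g k) ≤ D) :
    IsOpen {x ∈ Ω | ¬ IsLocallyL2BoundedAt Ω u x} := by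
  refine isOpen_iff_mem_nhds.2 fun x ⟨hxΩ, hx⟩ => ?_
  obtain ⟨r, hr, hrΩ⟩ := Metric.isOpen_iff.1 hΩ x hxΩ
  have h2 : ball x (2 * (r / 2)) ⊆ Ω := by rwa [mul_div_cancel₀ _ two_ne_zero]
  filter_upwards [ball_mem_nhds x (half_pos hr)] with y hy
  exact ⟨hrΩ (ball_subset_ball (by linarith) hy), fun hgood =>
    hx (isLocallyL2BoundedAt_of_mem_ball hΩ hb hu hD h2 hy hgood)⟩

/-- At a boundary point, translating in the direction of the axis moves a neighbourhood in `Ω` onto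
a relatively compact subset of `Ω`. -/
theorem isLocallyL2BoundedAt_of_mem_frontier {κ : Type*} {Ω : Set 𝔼} {u : κ → 𝔼 → ℝ}
    {g : κ → Fin d → 𝔼 → ℝ} (hΩ : IsOpen Ω) (hb : Bornology.IsBounded Ω)
    (hlip : HasLipschitzBoundary Ω)
    (hu : ∀ k, IsSobolevPair Ω (u k) (g k)) {D : ℝ≥0} (hD : ∀ k, gradEnergy (g k) ≤ D)
    (hgood : ∀ x ∈ Ω, IsLocallyL2BoundedAt Ω u x) {p : 𝔼} (hp : p ∈ frontier Ω) :
    IsLocallyL2BoundedAt Ω u p := by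
  obtain ⟨r, e, L, γ, hr, he, hγ, hΩp⟩ := hlip p hp
  have hproj : ∀ (x : 𝔼) (t : ℝ), (ℝ ∙ e)ᗮ.orthogonalProjectionOnto (x + t • e) =
      (ℝ ∙ e)ᗮ.orthogonalProjectionOnto x := fun x t => by
    rw [map_add, map_smul, Submodule.orthogonalProjectionOnto_orthogonalComplement_singleton_eq_zero,
      smul_zero, add_zero]
  have hinner : ∀ (x : 𝔼) (t : ℝ), ⟪e, x + t • e⟫ = ⟪e, x⟫ + t := fun x t => by
    rw [inner_add_right, inner_smul_right, real_inner_self_eq_norm_sq, he]; ring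
  have hmemΩ : ∀ y ∈ ball p r, γ ((ℝ ∙ e)ᗮ.orthogonalProjectionOnto y) < ⟪e, y⟫ → y ∈ Ω :=
    fun y hy hy' => (hΩp.symm.subset ⟨hy', hy⟩).1
  have hdist : ∀ y ∈ ball p (r / 4), ∀ t ∈ Icc (0 : ℝ) (r / 4), dist (y + t • e) p ≤ r / 2 := by
    intro y hy t ht
    have h1 : dist (y + t • e) y ≤ r / 4 := by
      simpa [dist_eq_norm, norm_smul, he, abs_of_nonneg ht.1] using ht.2
    have h2 := mem_ball.1 hy
    linarith [dist_triangle (y + t • e) y p]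
  set K : Set 𝔼 := {y | γ ((ℝ ∙ e)ᗮ.orthogonalProjectionOnto y) + r / 4 ≤ ⟪e, y⟫} ∩
    closedBall p (r / 2) with hK
  have hKc : IsCompact K := by
    refine (isCompact_closedBall p (r / 2)).inter_left (isClosed_le ?_ ?_)
    · exact (hγ.continuous.comp (ContinuousLinearMap.continuous _)).add continuous_const
    · fun_prop
  have hKΩ : K ⊆ Ω := fun y hy => hmemΩ y (closedBall_subset_ball (by linarith) hy.2)
    (by linarith [hy.1.out])
  obtain ⟨C, hC⟩ := exists_bound_of_isCompact hKc fun x hx => hgood x (hKΩ hx)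
  have hgraph : ∀ y ∈ ball p (r / 4) ∩ Ω, γ ((ℝ ∙ e)ᗮ.orthogonalProjectionOnto y) < ⟪e, y⟫ :=
    fun y hy => (hΩp.subset ⟨hy.2, ball_subset_ball (by linarith) hy.1⟩).1
  refine isLocallyL2BoundedAt_of_translate hΩ hb hu hD (h := (r / 4) • e) (B := K ∩ Ω)
    (ball_mem_nhds p (by linarith : 0 < r / 4)) ?_ ?_ hC
  · intro y hy τ hτ
    have ht : τ * (r / 4) ∈ Icc (0 : ℝ) (r / 4) :=
      ⟨mul_nonneg hτ.1 (by linarith), mul_le_of_le_one_left (by linarith) hτ.2⟩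
    rw [smul_smul]
    refine hmemΩ _ ((hdist y hy.1 _ ht).trans_lt (by linarith)) ?_
    rw [hproj, hinner]
    linarith [hgraph y hy, ht.1]
  · intro y hy
    have hyK : y + (r / 4) • e ∈ K := by
      refine ⟨?_, hdist y hy.1 _ ⟨by linarith, le_rfl⟩⟩
      change γ _ + r / 4 ≤ ⟪e, _⟫
      rw [hproj, hinner]
      linarith [hgraph y hy]
    exact ⟨hyK, hKΩ hyK⟩

/-- Local bounds inside a Lipschitz domain, together with a gradient bound, give a global bound. -/
theorem exists_bound_of_hasLipschitzBoundary {κ : Type*} {Ω : Set 𝔼} {u : κ → 𝔼 → ℝ}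
    {g : κ → Fin d → 𝔼 → ℝ} (hΩ : IsOpen Ω) (hb : Bornology.IsBounded Ω)
    (hlip : HasLipschitzBoundary Ω)
    (hu : ∀ k, IsSobolevPair Ω (u k) (g k)) {D : ℝ≥0} (hD : ∀ k, gradEnergy (g k) ≤ D)
    (hgood : ∀ x ∈ Ω, IsLocallyL2BoundedAt Ω u x) :
    ∃ C : ℝ≥0, ∀ k, ∫⁻ y, ‖u k y‖ₑ ^ 2 ≤ C := by
  obtain ⟨C, hC⟩ := exists_bound_of_isCompact hb.isCompact_closure (Ω := Ω) (u := u) fun x hx => by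
    by_cases hxΩ : x ∈ Ω
    · exact hgood x hxΩ
    · exact isLocallyL2BoundedAt_of_mem_frontier hΩ hb hlip hu hD hgood
        ⟨hx, fun h => hxΩ (interior_subset h)⟩
  refine ⟨C, fun k => ?_⟩
  rw [inter_eq_self_of_subset_right subset_closure] at hC
  refine le_of_eq_of_le ?_ (hC k)
  rw [← lintegral_indicator hΩ.measurableSet]
  refine lintegral_congr fun x => ?_
  by_cases hx : x ∈ Ω <;> simp [hx, (hu k).eq_zero]

/-! ### Operations on Sobolev functions -/

theorem IsSobolevPair.sub {Ω : Set 𝔼} {u v : 𝔼 → ℝ} {g h : Fin d → 𝔼 → ℝ}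
    (hb : Bornology.IsBounded Ω) (hu : IsSobolevPair Ω u g) (hv : IsSobolevPair Ω v h) :
    IsSobolevPair Ω (u - v) (g - h) where
  measurable := hu.measurable.sub hv.measurable
  measurable_grad j := (hu.measurable_grad j).sub (hv.measurable_grad j)
  eq_zero x hx := by simp [hu.eq_zero x hx, hv.eq_zero x hx]
  grad_eq_zero j x hx := by simp [hu.grad_eq_zero j x hx, hv.grad_eq_zero j x hx]
  memLp := hu.memLp.sub hv.memLp
  memLp_grad j := (hu.memLp_grad j).sub (hv.memLp_grad j)
  weak j φ hφ hc hs := by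
    have hdc : HasCompactSupport fun x => fderiv ℝ φ x (EuclideanSpace.single j 1) :=
      (hc.fderiv (𝕜 := ℝ)).comp_left (g := fun L : 𝔼 →L[ℝ] ℝ => L _) rfl
    have hd : Continuous fun x => fderiv ℝ φ x (EuclideanSpace.single j 1) :=
      (hφ.continuous_fderiv (by simp)).clm_apply continuous_const
    have i1 := integrable_mul_of_continuous_of_hasCompactSupport (hu.integrable hb) hd hdc
      measurable_id
    have i2 := integrable_mul_of_continuous_of_hasCompactSupport (hv.integrable hb) hd hdc
      measurable_id
    have i3 := integrable_mul_of_continuous_of_hasCompactSupport (hu.integrable_grad hb j)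
      hφ.continuous hc measurable_id
    have i4 := integrable_mul_of_continuous_of_hasCompactSupport (hv.integrable_grad hb j)
      hφ.continuous hc measurable_id
    simp only [id_eq] at i1 i2 i3 i4
    simp only [Pi.sub_apply, sub_mul]
    rw [integral_sub i1 i2, integral_sub i3 i4, hu.weak j φ hφ hc hs, hv.weak j φ hφ hc hs]
    ring

theorem gradEnergy_sub_le {g h : Fin d → 𝔼 → ℝ} (hg : ∀ j, Measurable (g j)) :
    gradEnergy (g - h) ≤ 2 * (gradEnergy g + gradEnergy h) := by
  unfold gradEnergy
  rw [← lintegral_add_left (Finset.measurable_sum _ fun j _ => (hg j).enorm.pow_const 2),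
    ← lintegral_const_mul' _ _ (by finiteness)]
  refine lintegral_mono fun x => ?_
  rw [← Finset.sum_add_distrib, Finset.mul_sum]
  refine Finset.sum_le_sum fun j _ => ?_
  refine (enorm_sq_le_two_mul _ (g j x)).trans_eq ?_
  simp

/-- Truncation of a test function to a relatively clopen subset of `Ω` is a test function. -/
theorem contDiff_indicator_of_tsupport_subset {Ω G : Set 𝔼} (hG : IsOpen G) (hG' : IsOpen (Ω \ G))
    {φ : 𝔼 → ℝ} (hφ : ContDiff ℝ ∞ φ) (hs : tsupport φ ⊆ Ω) :
    ContDiff ℝ ∞ (G.indicator φ) := by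
  refine contDiff_iff_contDiffAt.2 fun x => ?_
  by_cases hx : x ∈ tsupport φ
  · by_cases hxG : x ∈ G
    · refine hφ.contDiffAt.congr_of_eventuallyEq ?_
      filter_upwards [hG.mem_nhds hxG] with y hy
      exact indicator_of_mem hy φ
    · refine (contDiffAt_const (c := (0 : ℝ))).congr_of_eventuallyEq ?_
      filter_upwards [hG'.mem_nhds ⟨hs hx, hxG⟩] with y hy
      exact indicator_of_notMem hy.2 φ
  · refine (contDiffAt_const (c := (0 : ℝ))).congr_of_eventuallyEq ?_
    filter_upwards [notMem_tsupport_iff_eventuallyEq.1 hx] with y hy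
    exact indicator_apply_eq_zero.2 fun _ => hy

/-- Setting a Sobolev function to zero on a union of connected components of `Ω`. -/
theorem IsSobolevPair.indicator {Ω G : Set 𝔼} (hG : IsOpen G) (hG' : IsOpen (Ω \ G))
    {u : 𝔼 → ℝ} {g : Fin d → 𝔼 → ℝ} (hu : IsSobolevPair Ω u g) :
    IsSobolevPair Ω (G.indicator u) (fun j => G.indicator (g j)) where
  measurable := hu.measurable.indicator hG.measurableSet
  measurable_grad j := (hu.measurable_grad j).indicator hG.measurableSet
  eq_zero x hx := indicator_apply_eq_zero.2 fun _ => hu.eq_zero x hx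
  grad_eq_zero j x hx := indicator_apply_eq_zero.2 fun _ => hu.grad_eq_zero j x hx
  memLp := hu.memLp.indicator hG.measurableSet
  memLp_grad j := (hu.memLp_grad j).indicator hG.measurableSet
  weak j φ hφ hc hs := by
    have hsupp : Function.support (G.indicator φ) ⊆ Function.support φ := by
      rw [support_indicator]; exact inter_subset_right
    have e := hu.weak j (G.indicator φ) (contDiff_indicator_of_tsupport_subset hG hG' hφ hs)
      (hc.mono hsupp) ((closure_mono hsupp).trans hs)
    have e1 : ∀ x, u x * fderiv ℝ (G.indicator φ) x (EuclideanSpace.single j 1) =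
        G.indicator u x * fderiv ℝ φ x (EuclideanSpace.single j 1) := by
      intro x
      by_cases hxG : x ∈ G
      · have : G.indicator φ =ᶠ[𝓝 x] φ := by
          filter_upwards [hG.mem_nhds hxG] with y hy
          exact indicator_of_mem hy φ
        rw [this.fderiv_eq, indicator_of_mem hxG]
      · rw [indicator_of_notMem hxG, zero_mul]
        by_cases hxΩ : x ∈ Ω
        · have : G.indicator φ =ᶠ[𝓝 x] fun _ => 0 := by
            filter_upwards [hG'.mem_nhds ⟨hxΩ, hxG⟩] with y hy
            exact indicator_of_notMem hy.2 φ
          simp [this.fderiv_eq]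
        · rw [hu.eq_zero x hxΩ, zero_mul]
    have e2 : ∀ x, g j x * G.indicator φ x = G.indicator (g j) x * φ x := by
      intro x
      by_cases hxG : x ∈ G <;> simp [hxG]
    simp only [e1, e2] at e
    exact e

theorem gradEnergy_indicator_le (G : Set 𝔼) (g : Fin d → 𝔼 → ℝ) :
    gradEnergy (fun j => G.indicator (g j)) ≤ gradEnergy g := by
  refine lintegral_mono fun x => Finset.sum_le_sum fun j _ => ?_
  gcongr
  exact enorm_indicator_le_enorm_self _ _

/-! ### Vector-valued Sobolev maps -/

/-- The maps `U i`, with weak gradients `g i`, represent on `Ω` the components of `T`. -/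
def RepresentsOn (Ω : Set 𝔼) (T : 𝔼 → 𝔼) (U : Fin d → 𝔼 → ℝ) (g : Fin d → Fin d → 𝔼 → ℝ) : Prop :=
  ∀ i, IsSobolevPair Ω (U i) (g i) ∧ (fun x => T x i) =ᵐ[volume.restrict Ω] U i

theorem exists_measurable_extension {Ω : Set 𝔼} (hΩ : MeasurableSet Ω) {w : 𝔼 → ℝ}
    (hw : MemLp w 2 (volume.restrict Ω)) : ∃ v : 𝔼 → ℝ, Measurable v ∧ (∀ x ∉ Ω, v x = 0) ∧
      MemLp v 2 volume ∧ w =ᵐ[volume.restrict Ω] v := by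
  have hae : hw.1.mk w =ᵐ[volume.restrict Ω] w := hw.1.ae_eq_mk.symm
  refine ⟨Ω.indicator (hw.1.mk w), hw.1.stronglyMeasurable_mk.measurable.indicator hΩ,
    fun x hx => indicator_of_notMem hx _, ?_, ?_⟩
  · rw [memLp_indicator_iff_restrict hΩ]
    exact hw.ae_eq hae.symm
  · exact hae.symm.trans (indicator_ae_eq_restrict hΩ).symm

theorem setIntegral_mul_eq_of_ae_eq {Ω : Set 𝔼} {w v φ : 𝔼 → ℝ}
    (hv : ∀ x ∉ Ω, v x = 0) (hwv : w =ᵐ[volume.restrict Ω] v) :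
    ∫ x in Ω, w x * φ x = ∫ x, v x * φ x := by
  rw [← setIntegral_eq_integral_of_forall_compl_eq_zero (s := Ω) (f := fun x => v x * φ x)
    fun x hx => by rw [hv x hx, zero_mul]]
  refine integral_congr_ae ?_
  filter_upwards [hwv] with x hx
  rw [hx]

theorem MemH1.exists_representsOn {Ω : Set 𝔼} (hΩ : IsOpen Ω) {T : 𝔼 → 𝔼} (hT : MemH1 Ω T) :
    ∃ U g, RepresentsOn Ω T U g := by
  obtain ⟨hT2, G, hG, hG2⟩ := hT
  choose U hUm hU0 hU2 hUT using fun i =>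
    exists_measurable_extension hΩ.measurableSet (hT2.eval_piLp i)
  choose g hgm hg0 hg2 hgG using fun i j => exists_measurable_extension hΩ.measurableSet (hG2 i j)
  refine ⟨U, g, fun i => ⟨⟨hUm i, hgm i, hU0 i, hg0 i, hU2 i, hg2 i, ?_⟩, hUT i⟩⟩
  intro j φ hφ hc hs
  rw [← setIntegral_mul_eq_of_ae_eq (hU0 i) (hUT i),
    ← setIntegral_mul_eq_of_ae_eq (hg0 i j) (hgG i j)]
  exact (hG i j).2.2 φ hφ hc hs

theorem RepresentsOn.isWeakJacobian {Ω : Set 𝔼} (hb : Bornology.IsBounded Ω)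
    {T : 𝔼 → 𝔼} {U : Fin d → 𝔼 → ℝ} {g : Fin d → Fin d → 𝔼 → ℝ} (h : RepresentsOn Ω T U g) :
    IsWeakJacobian Ω T fun x => Matrix.of fun i j => g i j x := by
  intro i j
  have hU := (h i).1
  refine ⟨?_, ((hU.integrable_grad hb j).integrableOn.locallyIntegrableOn :
    LocallyIntegrableOn _ Ω), fun φ hφ hc hs => ?_⟩
  · have : IntegrableOn (fun x => T x i) Ω :=
      ((hU.integrable hb).integrableOn (s := Ω)).congr (h i).2.symm
    exact this.locallyIntegrableOn
  · rw [setIntegral_mul_eq_of_ae_eq hU.eq_zero (h i).2, hU.weak j φ hφ hc hs]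
    simp only [Matrix.of_apply]
    rw [setIntegral_mul_eq_of_ae_eq (hU.grad_eq_zero j) Filter.EventuallyEq.rfl]

theorem RepresentsOn.memH1 {Ω : Set 𝔼} (hb : Bornology.IsBounded Ω)
    {T : 𝔼 → 𝔼} {U : Fin d → 𝔼 → ℝ} {g : Fin d → Fin d → 𝔼 → ℝ} (h : RepresentsOn Ω T U g) :
    MemH1 Ω T :=
  ⟨MemLp.of_eval_piLp fun i => ((h i).1.memLp.restrict Ω).ae_eq (h i).2.symm,
    _, h.isWeakJacobian hb, fun i j => ((h i).1.memLp_grad j).restrict Ω⟩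

theorem RepresentsOn.dirichletEnergy_eq {Ω : Set 𝔼} (hΩ : IsOpen Ω) (hb : Bornology.IsBounded Ω)
    {T : 𝔼 → 𝔼} {U : Fin d → 𝔼 → ℝ} {g : Fin d → Fin d → 𝔼 → ℝ} (h : RepresentsOn Ω T U g) :
    dirichletEnergy Ω T = ∑ i, gradEnergy (g i) := by
  have hJ := (h.isWeakJacobian hb).weakJacobian_ae_eq hΩ
  calc dirichletEnergy Ω T = ∫⁻ x in Ω, ∑ i, ∑ j, ‖g i j x‖ₑ ^ 2 := by
        refine lintegral_congr_ae ?_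
        filter_upwards [hJ] with x hx
        simp [hx, enorm_sq_eq_ofReal_sq]
    _ = ∫⁻ x, ∑ i, ∑ j, ‖g i j x‖ₑ ^ 2 := by
        rw [← lintegral_indicator hΩ.measurableSet]
        refine lintegral_congr fun x => ?_
        by_cases hx : x ∈ Ω
        · simp [hx]
        · have : ∀ i j, g i j x = 0 := fun i j => (h i).1.grad_eq_zero j x hx
          simp [hx, this]
    _ = ∑ i, gradEnergy (g i) := lintegral_finsetSum _ fun i _ =>
        Finset.measurable_sum _ fun j _ => ((h i).1.measurable_grad j).enorm.pow_const 2

/-! ### Weak convergence in `L²` -/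

/-- Bounded sequences in a separable Hilbert space have weakly convergent subsequences. -/
theorem exists_subseq_tendsto_inner {H : Type*} [NormedAddCommGroup H] [InnerProductSpace ℝ H]
    [CompleteSpace H] [TopologicalSpace.SeparableSpace H] {x : ℕ → H} {R : ℝ}
    (hx : ∀ n, ‖x n‖ ≤ R) : ∃ (y : H) (φ : ℕ → ℕ), StrictMono φ ∧
      ∀ z, Filter.Tendsto (fun n => ⟪x (φ n), z⟫) Filter.atTop (𝓝 ⟪y, z⟫) := by
  have hmem : ∀ n, StrongDual.toWeakDual (InnerProductSpace.toDual ℝ H (x n)) ∈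
      (WeakDual.toStrongDual ⁻¹' closedBall (0 : StrongDual ℝ H) R : Set (WeakDual ℝ H)) := by
    intro n
    simpa using hx n
  obtain ⟨y, -, φ, hφ, hlim⟩ := WeakDual.isSeqCompact_closedBall ℝ H 0 R hmem
  refine ⟨(InnerProductSpace.toDual ℝ H).symm (WeakDual.toStrongDual y), φ, hφ, fun z => ?_⟩
  rw [InnerProductSpace.toDual_symm_apply]
  exact ((WeakBilin.eval_continuous (topDualPairing ℝ H) z).tendsto y).comp hlim

/-- Weak convergence `f n ⇀ F` in `L²` of the whole space, stated for functions rather than classes: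
the integrals against every square-integrable `ψ` converge. -/
def WeakTendsto (f : ℕ → 𝔼 → ℝ) (F : 𝔼 → ℝ) : Prop :=
  ∀ ψ : 𝔼 → ℝ, MemLp ψ 2 volume →
    Filter.Tendsto (fun n => ∫ x, f n x * ψ x) Filter.atTop (𝓝 (∫ x, F x * ψ x))

theorem WeakTendsto.comp {f : ℕ → 𝔼 → ℝ} {F : 𝔼 → ℝ} (h : WeakTendsto f F) {φ : ℕ → ℕ}
    (hφ : StrictMono φ) : WeakTendsto (fun n => f (φ n)) F :=
  fun ψ hψ => (h ψ hψ).comp hφ.tendsto_atTop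

theorem lintegral_enorm_sq_eq_ofReal {f : 𝔼 → ℝ} (hf : MemLp f 2 volume) :
    ∫⁻ x, ‖f x‖ₑ ^ 2 = ENNReal.ofReal (∫ x, f x ^ 2) := by
  rw [ofReal_integral_eq_lintegral_ofReal hf.integrable_sq
    (Filter.Eventually.of_forall fun x => sq_nonneg _)]
  exact lintegral_congr fun x => enorm_sq_eq_ofReal_sq _

theorem exists_subseq_weakTendsto {f : ℕ → 𝔼 → ℝ} (hf : ∀ n, MemLp (f n) 2 volume) {C : ℝ≥0}
    (hC : ∀ n, ∫⁻ x, ‖f n x‖ₑ ^ 2 ≤ C) : ∃ (F : 𝔼 → ℝ) (φ : ℕ → ℕ), MemLp F 2 volume ∧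
      StrictMono φ ∧ WeakTendsto (fun n => f (φ n)) F := by
  have hinner : ∀ {a b : 𝔼 → ℝ} (ha : MemLp a 2 volume) (hb : MemLp b 2 volume),
      ⟪ha.toLp a, hb.toLp b⟫ = ∫ x, a x * b x := by
    intro a b ha hb
    rw [L2.inner_def]
    refine integral_congr_ae ?_
    filter_upwards [ha.coeFn_toLp, hb.coeFn_toLp] with x h1 h2
    rw [h1, h2]
    simp [mul_comm]
  have hbound : ∀ n, ‖(hf n).toLp (f n)‖ ≤ Real.sqrt C := by
    intro n
    refine Real.le_sqrt_of_sq_le ?_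
    rw [← real_inner_self_eq_norm_sq, hinner]
    have h := hC n
    rw [lintegral_enorm_sq_eq_ofReal (hf n)] at h
    simpa [sq] using (ENNReal.ofReal_le_iff_le_toReal ENNReal.coe_ne_top).1 h
  have : Fact ((2 : ℝ≥0∞) ≠ ⊤) := ⟨ENNReal.ofNat_ne_top⟩
  obtain ⟨y, φ, hφ, hlim⟩ := exists_subseq_tendsto_inner hbound
  refine ⟨y, φ, Lp.memLp y, hφ, fun ψ hψ => ?_⟩
  have h := hlim (hψ.toLp ψ)
  have e : ⟪y, hψ.toLp ψ⟫ = ∫ x, y x * ψ x := by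
    rw [← hinner (Lp.memLp y) hψ, Lp.toLp_coeFn]
  simpa only [hinner, e] using h

/-- Weak compactness for finitely many sequences supported in `Ω`, along a common subsequence. -/
theorem exists_subseq_forall_weakTendsto {ι : Type*} [Finite ι] {Ω : Set 𝔼} (hΩ : MeasurableSet Ω)
    {f : ι → ℕ → 𝔼 → ℝ} (hf : ∀ i n, MemLp (f i n) 2 volume) (h0 : ∀ i n, ∀ x ∉ Ω, f i n x = 0)
    {C : ℝ≥0} (hC : ∀ i n, ∫⁻ x, ‖f i n x‖ₑ ^ 2 ≤ C) :
    ∃ (F : ι → 𝔼 → ℝ) (φ : ℕ → ℕ), StrictMono φ ∧ (∀ i, Measurable (F i)) ∧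
      (∀ i, ∀ x ∉ Ω, F i x = 0) ∧ (∀ i, MemLp (F i) 2 volume) ∧
      ∀ i, WeakTendsto (fun n => f i (φ n)) (F i) := by
  classical
  have := Fintype.ofFinite ι
  have main : ∀ s : Finset ι, ∃ φ : ℕ → ℕ, StrictMono φ ∧ ∀ i ∈ s, ∃ F : 𝔼 → ℝ,
      MemLp F 2 volume ∧ WeakTendsto (fun n => f i (φ n)) F := by
    intro s
    induction s using Finset.induction_on with
    | empty => exact ⟨id, strictMono_id, by simp⟩
    | insert a s ha ih =>
      obtain ⟨φ, hφ, h⟩ := ih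
      obtain ⟨F, χ, hF, hχ, hlim⟩ := exists_subseq_weakTendsto (fun n => hf a (φ n))
        (fun n => hC a (φ n))
      refine ⟨φ ∘ χ, hφ.comp hχ, fun i hi => ?_⟩
      rcases Finset.mem_insert.1 hi with rfl | hi
      · exact ⟨F, hF, hlim⟩
      · obtain ⟨F', hF', hlim'⟩ := h i hi
        exact ⟨F', hF', hlim'.comp hχ⟩
  obtain ⟨φ, hφ, h⟩ := main Finset.univ
  choose F hF hlim using fun i => h i (Finset.mem_univ i)
  choose F' hF'm hF'0 hF' hFF' using fun i =>
    exists_measurable_extension hΩ ((hF i).restrict Ω)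
  refine ⟨F', φ, hφ, hF'm, hF'0, hF', fun i ψ hψ => ?_⟩
  have h1 := hlim i (Ω.indicator ψ) (hψ.indicator hΩ)
  have e : ∀ v : 𝔼 → ℝ, ∫ x, v x * Ω.indicator ψ x = ∫ x in Ω, v x * ψ x := by
    intro v
    rw [← integral_indicator hΩ]
    congr 1
    ext x
    by_cases hx : x ∈ Ω <;> simp [hx]
  simp only [e] at h1
  rw [setIntegral_mul_eq_of_ae_eq (hF'0 i) (hFF' i)] at h1
  refine h1.congr fun n => ?_
  exact setIntegral_mul_eq_of_ae_eq (h0 i _) Filter.EventuallyEq.rfl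

/-- The graph of the weak gradient is closed under weak convergence. -/
theorem IsSobolevPair.of_weakTendsto {Ω : Set 𝔼} {u : ℕ → 𝔼 → ℝ} {g : ℕ → Fin d → 𝔼 → ℝ}
    (hu : ∀ n, IsSobolevPair Ω (u n) (g n)) {v : 𝔼 → ℝ} {w : Fin d → 𝔼 → ℝ}
    (hvm : Measurable v) (hwm : ∀ j, Measurable (w j)) (hv0 : ∀ x ∉ Ω, v x = 0)
    (hw0 : ∀ j, ∀ x ∉ Ω, w j x = 0) (hv : MemLp v 2 volume) (hw : ∀ j, MemLp (w j) 2 volume)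
    (huv : WeakTendsto u v) (hgw : ∀ j, WeakTendsto (fun n => g n j) (w j)) :
    IsSobolevPair Ω v w where
  measurable := hvm
  measurable_grad := hwm
  eq_zero := hv0
  grad_eq_zero := hw0
  memLp := hv
  memLp_grad := hw
  weak j φ hφ hc hs := by
    have hdc : HasCompactSupport fun x => fderiv ℝ φ x (EuclideanSpace.single j 1) :=
      (hc.fderiv (𝕜 := ℝ)).comp_left (g := fun L : 𝔼 →L[ℝ] ℝ => L _) rfl
    have hd : Continuous fun x => fderiv ℝ φ x (EuclideanSpace.single j 1) :=
      (hφ.continuous_fderiv (by simp)).clm_apply continuous_const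
    refine tendsto_nhds_unique (huv _ (hd.memLp_of_hasCompactSupport hdc)) ?_
    refine (hgw j φ (hφ.continuous.memLp_of_hasCompactSupport hc)).neg.congr fun n => ?_
    exact ((hu n).weak j φ hφ hc hs).symm

theorem WeakTendsto.lintegral_enorm_sq_le_liminf {f : ℕ → 𝔼 → ℝ} {F : 𝔼 → ℝ}
    (h : WeakTendsto f F) (hf : ∀ n, MemLp (f n) 2 volume) (hF : MemLp F 2 volume) :
    ∫⁻ x, ‖F x‖ₑ ^ 2 ≤ Filter.liminf (fun n => ∫⁻ x, ‖f n x‖ₑ ^ 2) Filter.atTop := by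
  -- `2 ⟨f n, F⟩ - ‖F‖² ≤ ‖f n‖²`, and the left-hand side tends to `‖F‖²`
  have h1 : Filter.Tendsto
      (fun n => ENNReal.ofReal (2 * (∫ x, f n x * F x) - ∫ x, F x ^ 2)) Filter.atTop
      (𝓝 (∫⁻ x, ‖F x‖ₑ ^ 2)) := by
    rw [lintegral_enorm_sq_eq_ofReal hF]
    refine ENNReal.tendsto_ofReal ?_
    have e : ∫ x, F x ^ 2 = 2 * (∫ x, F x * F x) - ∫ x, F x ^ 2 := by
      simp_rw [← sq]; ring
    conv => enter [3]; rw [e]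
    exact ((h F hF).const_mul 2).sub_const _
  rw [← h1.liminf_eq]
  refine Filter.liminf_le_liminf (Filter.Eventually.of_forall fun n => ?_)
  rw [lintegral_enorm_sq_eq_ofReal (hf n)]
  refine ENNReal.ofReal_le_ofReal ?_
  have hi : Integrable fun x => f n x * F x := (hf n).integrable_mul hF
  rw [← integral_const_mul, ← integral_sub (hi.const_mul 2) hF.integrable_sq]
  refine integral_mono ((hi.const_mul 2).sub hF.integrable_sq) (hf n).integrable_sq fun x => ?_
  simp only
  nlinarith [sq_nonneg (f n x - F x)]

/-- Fatou's lemma for the counting measure on a finite type. -/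
theorem sum_liminf_le_liminf_sum {ι : Type*} [Fintype ι] (a : ι → ℕ → ℝ≥0∞) :
    ∑ i, Filter.liminf (a i) Filter.atTop ≤ Filter.liminf (fun n => ∑ i, a i n) Filter.atTop := by
  let _ : MeasurableSpace ι := ⊤
  have h := lintegral_liminf_le (μ := Measure.count) (f := fun n i => a i n) (u := Filter.atTop)
    fun n => measurable_from_top
  simpa only [lintegral_count, tsum_fintype] using h

theorem liminf_add_liminf_le (a b : ℕ → ℝ≥0∞) :
    Filter.liminf a Filter.atTop + Filter.liminf b Filter.atTop ≤
      Filter.liminf (fun n => a n + b n) Filter.atTop := by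
  simpa using sum_liminf_le_liminf_sum fun i : Bool => bif i then a else b

theorem gradEnergy_eq_sum {g : Fin d → 𝔼 → ℝ} (hg : ∀ j, Measurable (g j)) :
    gradEnergy g = ∑ j, ∫⁻ x, ‖g j x‖ₑ ^ 2 :=
  lintegral_finsetSum _ fun j _ => (hg j).enorm.pow_const 2

theorem gradEnergy_le_liminf {Ω : Set 𝔼} {u : ℕ → 𝔼 → ℝ} {g : ℕ → Fin d → 𝔼 → ℝ}
    (hu : ∀ n, IsSobolevPair Ω (u n) (g n)) {v : 𝔼 → ℝ} {w : Fin d → 𝔼 → ℝ}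
    (hv : IsSobolevPair Ω v w) (hgw : ∀ j, WeakTendsto (fun n => g n j) (w j)) :
    gradEnergy w ≤ Filter.liminf (fun n => gradEnergy (g n)) Filter.atTop := by
  simp_rw [gradEnergy_eq_sum hv.measurable_grad, gradEnergy_eq_sum (hu _).measurable_grad]
  refine le_trans (Finset.sum_le_sum fun j _ => ?_) (sum_liminf_le_liminf_sum _)
  exact (hgw j).lintegral_enorm_sq_le_liminf (fun n => (hu n).memLp_grad j) (hv.memLp_grad j)

/-! ### Rellich's theorem -/

/-- Comparison of a Sobolev function with its averages over balls of radius `δ`. -/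
theorem IsSobolevPair.sq_mul_lintegral_le_of_ball {Ω : Set 𝔼} {w : 𝔼 → ℝ} {g : Fin d → 𝔼 → ℝ}
    (hΩ : IsOpen Ω) (hb : Bornology.IsBounded Ω) (hw : IsSobolevPair Ω w g) {K : Set 𝔼} {δ : ℝ}
    (hK : Metric.thickening δ K ⊆ Ω) :
    volume (ball (0 : 𝔼) δ) ^ 2 * ∫⁻ x in K, ‖w x‖ₑ ^ 2 ≤
      2 * ((∫⁻ x in K, ‖∫ h in ball (0 : 𝔼) δ, w (x + h)‖ₑ ^ 2) +
        volume (ball (0 : 𝔼) δ) ^ 2 * (ENNReal.ofReal δ ^ 2 * gradEnergy g)) := by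
  set B := ball (0 : 𝔼) δ with hB
  have hBtop : volume B ≠ ⊤ := measure_ball_lt_top.ne
  have hwm := hw.measurable
  have hwi := hw.integrable hb
  have hm2 : Measurable fun p : 𝔼 × 𝔼 => ‖w (p.1 + p.2) - w p.1‖ₑ ^ 2 :=
    Measurable.pow_const (Measurable.enorm
      ((hwm.comp (by fun_prop)).sub (hwm.comp measurable_fst))) 2
  have hAm : Measurable fun x => ∫ h in B, w (x + h) := by
    have : StronglyMeasurable fun p : 𝔼 × 𝔼 => w (p.1 + p.2) :=
      (hwm.comp (by fun_prop)).stronglyMeasurable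
    exact (this.integral_prod_right (ν := volume.restrict B)).measurable
  have hx : ∀ x, volume B ^ 2 * ‖w x‖ₑ ^ 2 ≤ 2 * (‖∫ h in B, w (x + h)‖ₑ ^ 2 +
      volume B * ∫⁻ h in B, ‖w (x + h) - w x‖ₑ ^ 2) := by
    intro x
    have hi : Integrable (fun h => w (x + h)) (volume.restrict B) :=
      (hwi.comp_add_left x).restrict
    have hic : Integrable (fun _ => w x) (volume.restrict B) :=
      integrable_const_iff.2 (Or.inr ⟨by simpa using hBtop.lt_top⟩)
    have e : (∫ h in B, w (x + h)) - ∫ _ in B, w x = ∫ h in B, (w (x + h) - w x) :=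
      (integral_sub hi hic).symm
    have e2 : ‖∫ _ in B, w x‖ₑ = volume B * ‖w x‖ₑ := by
      rw [setIntegral_const, smul_eq_mul, enorm_mul, Real.enorm_of_nonneg measureReal_nonneg,
        ofReal_measureReal hBtop]
    calc volume B ^ 2 * ‖w x‖ₑ ^ 2 = ‖∫ _ in B, w x‖ₑ ^ 2 := by rw [e2, mul_pow]
      _ ≤ 2 * (‖∫ h in B, w (x + h)‖ₑ ^ 2 + ‖∫ h in B, (w (x + h) - w x)‖ₑ ^ 2) := by
          rw [← e]; exact enorm_sq_le_two_mul _ _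
      _ ≤ _ := by
          gcongr
          calc ‖∫ h in B, (w (x + h) - w x)‖ₑ ^ 2
              ≤ (∫⁻ h in B, ‖w (x + h) - w x‖ₑ) ^ 2 := by
                gcongr; exact enorm_integral_le_lintegral_enorm _
            _ ≤ _ := by
                simpa using sq_lintegral_le (m := volume.restrict B)
                  (F := fun h => ‖w (x + h) - w x‖ₑ)
                  ((hwm.comp (by fun_prop)).sub measurable_const).enorm.aemeasurable
  have hdouble : ∫⁻ x in K, ∫⁻ h in B, ‖w (x + h) - w x‖ₑ ^ 2 ≤
      volume B * (ENNReal.ofReal δ ^ 2 * gradEnergy g) := by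
    rw [lintegral_lintegral_swap hm2.aemeasurable]
    calc ∫⁻ h in B, ∫⁻ x in K, ‖w (x + h) - w x‖ₑ ^ 2
        ≤ ∫⁻ _ in B, ENNReal.ofReal δ ^ 2 * gradEnergy g := by
          refine setLIntegral_mono' measurableSet_ball fun h hh => ?_
          have hnorm : ‖h‖ < δ := mem_ball_zero_iff.1 hh
          refine (hw.lintegral_sub_sq_le hΩ hb fun x hx τ hτ => hK ?_).trans ?_
          · refine Metric.mem_thickening_iff.2 ⟨x, hx, ?_⟩
            rw [dist_eq_norm, add_sub_cancel_left, norm_smul, Real.norm_of_nonneg hτ.1]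
            exact (mul_le_of_le_one_left (norm_nonneg h) hτ.2).trans_lt hnorm
          · gcongr
            rw [← ofReal_norm]
            exact ENNReal.ofReal_le_ofReal hnorm.le
      _ = _ := by simp [mul_comm]
  calc volume B ^ 2 * ∫⁻ x in K, ‖w x‖ₑ ^ 2
      = ∫⁻ x in K, volume B ^ 2 * ‖w x‖ₑ ^ 2 :=
        (lintegral_const_mul _ (hwm.enorm.pow_const 2)).symm
    _ ≤ ∫⁻ x in K, 2 * (‖∫ h in B, w (x + h)‖ₑ ^ 2 +
          volume B * ∫⁻ h in B, ‖w (x + h) - w x‖ₑ ^ 2) := lintegral_mono hx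
    _ = 2 * ((∫⁻ x in K, ‖∫ h in B, w (x + h)‖ₑ ^ 2) +
          volume B * ∫⁻ x in K, ∫⁻ h in B, ‖w (x + h) - w x‖ₑ ^ 2) := by
        rw [lintegral_const_mul' _ _ (by finiteness),
          lintegral_add_left (hAm.enorm.pow_const 2), lintegral_const_mul' _ _ hBtop]
    _ ≤ _ := by
        rw [sq (volume B), mul_assoc]
        gcongr

/-- The averages over balls of a bounded weakly null sequence tend to zero in `L²` of compact
sets. -/
theorem WeakTendsto.tendsto_lintegral_average {Ω : Set 𝔼} {w : ℕ → 𝔼 → ℝ}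
    {g : ℕ → Fin d → 𝔼 → ℝ}
    (hw : ∀ n, IsSobolevPair Ω (w n) (g n)) (hlim : WeakTendsto w 0) {C : ℝ≥0}
    (hC : ∀ n, ∫⁻ x, ‖w n x‖ₑ ^ 2 ≤ C) {K : Set 𝔼} (hK : IsCompact K) (δ : ℝ) :
    Filter.Tendsto (fun n => ∫⁻ x in K, ‖∫ h in ball (0 : 𝔼) δ, w n (x + h)‖ₑ ^ 2)
      Filter.atTop (𝓝 0) := by
  set B := ball (0 : 𝔼) δ with hB
  have hBtop : volume B ≠ ⊤ := measure_ball_lt_top.ne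
  have hwm := fun n => (hw n).measurable
  have hAm : ∀ n, Measurable fun x => ∫ h in B, w n (x + h) := fun n => by
    have : StronglyMeasurable fun p : 𝔼 × 𝔼 => w n (p.1 + p.2) :=
      ((hwm n).comp (by fun_prop)).stronglyMeasurable
    exact (this.integral_prod_right (ν := volume.restrict B)).measurable
  have hzero : ∫⁻ _ in K, (0 : ℝ≥0∞) = 0 := lintegral_zero
  rw [← hzero]
  refine tendsto_lintegral_of_dominated_convergence (fun _ => volume B * C)
    (fun n => (hAm n).enorm.pow_const 2) (fun n => Filter.Eventually.of_forall fun x => ?_) ?_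
    (Filter.Eventually.of_forall fun x => ?_)
  · calc ‖∫ h in B, w n (x + h)‖ₑ ^ 2 ≤ (∫⁻ h in B, ‖w n (x + h)‖ₑ) ^ 2 := by
          gcongr; exact enorm_integral_le_lintegral_enorm _
      _ ≤ volume B * ∫⁻ h in B, ‖w n (x + h)‖ₑ ^ 2 := by
          simpa using sq_lintegral_le (m := volume.restrict B) (F := fun h => ‖w n (x + h)‖ₑ)
            ((hwm n).comp (by fun_prop)).enorm.aemeasurable
      _ ≤ volume B * C := by
          gcongr
          refine (setLIntegral_le_lintegral _ _).trans ?_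
          rw [lintegral_add_left_eq_self (fun y => ‖w n y‖ₑ ^ 2) x]
          exact hC n
  · rw [lintegral_const, Measure.restrict_apply_univ]
    exact ENNReal.mul_ne_top (ENNReal.mul_ne_top hBtop ENNReal.coe_ne_top) hK.measure_lt_top.ne
  · have hψ : MemLp ((ball x δ).indicator fun _ => (1 : ℝ)) 2 volume :=
      memLp_indicator_const 2 measurableSet_ball 1 (Or.inr measure_ball_lt_top.ne)
    have e : ∀ n, ∫ h in B, w n (x + h) =
        ∫ y, w n y * (ball x δ).indicator (fun _ => (1 : ℝ)) y := by
      intro n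
      rw [← integral_indicator measurableSet_ball, ← integral_add_left_eq_self
        (fun y => w n y * (ball x δ).indicator (fun _ => (1 : ℝ)) y) x]
      congr 1
      ext h
      by_cases hh : ‖h‖ < δ <;> simp [indicator, hh]
    have h1 := hlim _ hψ
    simp only [← e, Pi.zero_apply, zero_mul, integral_zero] at h1
    simpa [Function.comp_def] using ((ENNReal.continuous_pow 2).tendsto _).comp h1.enorm

/-- A sequence which is bounded in `H¹(Ω)` and weakly null in `L²` is strongly null in `L²` of the
compact subsets of `Ω`. -/
theorem WeakTendsto.tendsto_lintegral_sq {Ω : Set 𝔼} {w : ℕ → 𝔼 → ℝ}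
    {g : ℕ → Fin d → 𝔼 → ℝ} (hΩ : IsOpen Ω) (hb : Bornology.IsBounded Ω)
    (hw : ∀ n, IsSobolevPair Ω (w n) (g n)) (hlim : WeakTendsto w 0) {C D : ℝ≥0}
    (hC : ∀ n, ∫⁻ x, ‖w n x‖ₑ ^ 2 ≤ C) (hD : ∀ n, gradEnergy (g n) ≤ D) {K : Set 𝔼}
    (hK : IsCompact K) (hKΩ : K ⊆ Ω) :
    Filter.Tendsto (fun n => ∫⁻ x in K, ‖w n x‖ₑ ^ 2) Filter.atTop (𝓝 0) := by
  obtain ⟨δ₀, hδ₀, hthick⟩ := hK.exists_thickening_subset_open hΩ hKΩ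
  refine ENNReal.tendsto_nhds_zero.2 fun ε hε => ?_
  -- the radius `δ` of the averages is chosen so that the gradient term is at most `ε / 2`
  obtain ⟨δ, hδ, hδδ₀, hδε⟩ : ∃ δ : ℝ, 0 < δ ∧ δ ≤ δ₀ ∧
      2 * (ENNReal.ofReal δ ^ 2 * D) ≤ ε / 2 := by
    have h1 : Filter.Tendsto (fun δ : ℝ => 2 * (ENNReal.ofReal δ ^ 2 * D)) (𝓝[>] 0) (𝓝 0) := by
      have : Continuous fun δ : ℝ => 2 * (ENNReal.ofReal δ ^ 2 * D) :=
        (ENNReal.continuous_const_mul (by finiteness)).comp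
          ((ENNReal.continuous_mul_const ENNReal.coe_ne_top).comp
            ((ENNReal.continuous_pow 2).comp ENNReal.continuous_ofReal))
      simpa using (this.tendsto 0).mono_left nhdsWithin_le_nhds
    have h2 := ENNReal.tendsto_nhds_zero.1 h1 (ε / 2) (ENNReal.half_pos hε.ne')
    obtain ⟨δ, h3, h4⟩ := (h2.and (Ioc_mem_nhdsGT hδ₀)).exists
    exact ⟨δ, h4.1, h4.2, h3⟩
  set b := volume (ball (0 : 𝔼) δ) ^ 2 with hbdef
  have hb0 : b ≠ 0 := pow_ne_zero _ (measure_ball_pos volume 0 hδ).ne'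
  have hbtop : b ≠ ⊤ := ENNReal.pow_ne_top measure_ball_lt_top.ne
  have hav := ENNReal.Tendsto.const_mul (a := b⁻¹ * 2)
    (hlim.tendsto_lintegral_average hw hC hK δ)
    (Or.inr (ENNReal.mul_ne_top (ENNReal.inv_ne_top.2 hb0) (by finiteness)))
  rw [mul_zero] at hav
  filter_upwards [ENNReal.tendsto_nhds_zero.1 hav (ε / 2) (ENNReal.half_pos hε.ne')] with n hn
  have h1 := (hw n).sq_mul_lintegral_le_of_ball hΩ hb
    ((Metric.thickening_mono hδδ₀ K).trans hthick)
  rw [← hbdef] at h1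
  set I := ∫⁻ x in K, ‖∫ h in ball (0 : 𝔼) δ, w n (x + h)‖ₑ ^ 2
  calc ∫⁻ x in K, ‖w n x‖ₑ ^ 2 = b⁻¹ * (b * ∫⁻ x in K, ‖w n x‖ₑ ^ 2) := by
        rw [← mul_assoc, ENNReal.inv_mul_cancel hb0 hbtop, one_mul]
    _ ≤ b⁻¹ * (2 * (I + b * (ENNReal.ofReal δ ^ 2 * D))) := by
        refine mul_le_mul_right (h1.trans ?_) _
        gcongr
        exact hD n
    _ = b⁻¹ * 2 * I + 2 * ((b⁻¹ * b) * (ENNReal.ofReal δ ^ 2 * D)) := by ring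
    _ ≤ ε / 2 + ε / 2 := by
        rw [ENNReal.inv_mul_cancel hb0 hbtop, one_mul]
        exact add_le_add hn hδε
    _ = ε := ENNReal.add_halves ε

/-- Convergence to zero of the integrals over all compact subsets of `Ω` gives almost everywhere
convergence along a subsequence, chosen so that the integrals over an exhaustion are summable. -/
theorem exists_subseq_ae_tendsto_zero {Ω : Set 𝔼} (hΩ : IsOpen Ω) (hb : Bornology.IsBounded Ω)
    {s : ℕ → 𝔼 → ℝ≥0∞} (hs : ∀ n, Measurable (s n))
    (h : ∀ K, IsCompact K → K ⊆ Ω →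
      Filter.Tendsto (fun n => ∫⁻ x in K, s n x) Filter.atTop (𝓝 0)) :
    ∃ φ : ℕ → ℕ, StrictMono φ ∧
      ∀ᵐ x, x ∈ Ω → Filter.Tendsto (fun n => s (φ n) x) Filter.atTop (𝓝 0) := by
  obtain ⟨K, hKc, hKΩ, hKU, hKmono⟩ := hΩ.exists_iUnion_isClosed
  have hKcpt : ∀ m, IsCompact (K m) := fun m =>
    Metric.isCompact_of_isClosed_isBounded (hKc m) (hb.subset (hKΩ m))
  obtain ⟨φ, hφ, hφK⟩ := Filter.extraction_forall_of_eventually'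
    (P := fun m n => ∫⁻ x in K m, s n x ≤ (2⁻¹ : ℝ≥0∞) ^ m) fun m =>
      Filter.eventually_atTop.1 (ENNReal.tendsto_nhds_zero.1 (h (K m) (hKcpt m) (hKΩ m)) _
        (ENNReal.pow_pos (by simp) m))
  refine ⟨φ, hφ, ?_⟩
  have hmeas : ∀ m, Measurable ((K m).indicator (s (φ m))) := fun m =>
    (hs _).indicator (hKc m).measurableSet
  have hsum : ∫⁻ x, ∑' m, (K m).indicator (s (φ m)) x ≠ ⊤ := by
    rw [lintegral_tsum fun m => (hmeas m).aemeasurable]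
    refine ne_top_of_le_ne_top (b := ∑' m : ℕ, (2⁻¹ : ℝ≥0∞) ^ m) ?_
      (ENNReal.tsum_le_tsum fun m => ?_)
    · rw [ENNReal.tsum_geometric]; norm_num
    · rw [lintegral_indicator (hKc m).measurableSet]; exact hφK m
  filter_upwards [ae_lt_top (Measurable.tsum hmeas) hsum] with x hx hxΩ
  obtain ⟨m, hm⟩ := mem_iUnion.1 (hKU.symm ▸ hxΩ)
  have h0 := ENNReal.tendsto_atTop_zero_of_tsum_ne_top hx.ne
  refine h0.congr' ?_
  filter_upwards [Filter.eventually_ge_atTop m] with n hn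
  exact indicator_of_mem (hKmono hn hm) _

/-! ### Image measures -/

theorem map_eq_of_ae_tendsto {μ ν : Measure 𝔼} [IsProbabilityMeasure μ] {T : ℕ → 𝔼 → 𝔼} {S : 𝔼 → 𝔼}
    (hT : ∀ n, AEMeasurable (T n) μ) (hν : ∀ n, Measure.map (T n) μ = ν)
    (hlim : ∀ᵐ x ∂μ, Filter.Tendsto (fun n => T n x) Filter.atTop (𝓝 (S x))) :
    Measure.map S μ = ν := by
  have hS : AEMeasurable S μ := aemeasurable_of_tendsto_metrizable_ae Filter.atTop hT hlim
  have : IsProbabilityMeasure ν := hν 0 ▸ Measure.isProbabilityMeasure_map (hT 0)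
  have := Measure.isProbabilityMeasure_map hS
  refine ext_of_forall_integral_eq_of_IsFiniteMeasure fun ψ => ?_
  have hψ : Continuous ψ := ψ.continuous
  have e : ∀ n, ∫ x, ψ (T n x) ∂μ = ∫ y, ψ y ∂ν := fun n => by
    rw [← hν n, integral_map (hT n) hψ.aestronglyMeasurable]
  rw [integral_map hS hψ.aestronglyMeasurable]
  refine tendsto_nhds_unique (f := fun n => ∫ x, ψ (T n x) ∂μ) (l := Filter.atTop) ?_
    (by simp only [e]; exact tendsto_const_nhds)
  refine tendsto_integral_of_dominated_convergence (fun _ => ‖ψ‖)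
    (fun n => (hψ.measurable.comp_aemeasurable (hT n)).aestronglyMeasurable)
    (integrable_const _) (fun n => Filter.Eventually.of_forall fun x => ψ.norm_coe_le_norm _) ?_
  filter_upwards [hlim] with x hx
  exact (hψ.tendsto _).comp hx

theorem absolutelyContinuous_restrict {Ω : Set 𝔼} {μ : Measure 𝔼}
    (hμΩ : μ Ωᶜ = 0) (hμ : μ ≪ volume) : μ ≪ volume.restrict Ω := by
  have : μ.restrict Ω = μ := Measure.restrict_eq_self_of_ae_mem (mem_ae_iff.2 hμΩ)
  rw [← this]
  exact hμ.restrict Ω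

/-- Maps with the same image measure and bounded gradients are bounded in `L²` near every point of
the support of `μ`: by tightness of `ν` all of them take values in one bounded set on a part of a
given ball which has a definite proportion of the mass, hence Lebesgue measure bounded below, so
that Poincaré's inequality applies. -/
theorem isLocallyL2BoundedAt_of_measure_ball_ne_zero {Ω : Set 𝔼} (hΩ : IsOpen Ω)
    (hb : Bornology.IsBounded Ω) {μ ν : Measure 𝔼} [IsProbabilityMeasure μ]
    [IsProbabilityMeasure ν] {f : 𝔼 → ℝ≥0∞} (hμf : μ = volume.withDensity f)
    (hμ : μ ≪ volume.restrict Ω) {T : ℕ → 𝔼 → 𝔼} (hT : ∀ n, AEMeasurable (T n) μ)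
    (hν : ∀ n, Measure.map (T n) μ = ν) {U : ℕ → Fin d → 𝔼 → ℝ} {g : ℕ → Fin d → Fin d → 𝔼 → ℝ}
    (hU : ∀ n, RepresentsOn Ω (T n) (U n) (g n)) {D : ℝ≥0} (hD : ∀ n i, gradEnergy (g n i) ≤ D)
    {x : 𝔼} {r : ℝ} (hr : 0 < r) (hball : ball x r ⊆ Ω) (hx : μ (ball x r) ≠ 0) :
    IsLocallyL2BoundedAt Ω (fun k : ℕ × Fin d => U k.1 k.2) x := by
  set a := μ (ball x r) with ha
  have ha2 : 0 < a / 2 := ENNReal.half_pos hx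
  have hatop : a ≠ ⊤ := measure_ne_top _ _
  obtain ⟨K, hK, hνK⟩ := isTightMeasureSet_iff_exists_isCompact_measure_compl_le.1
    (isTightMeasureSet_singleton (μ := ν)) (a / 2) ha2
  obtain ⟨M', hM'⟩ := hK.isBounded.exists_norm_le
  set M : ℝ≥0 := M'.toNNReal
  have hM : ∀ y ∈ K, ∀ i, ‖y i‖ₑ ≤ M := fun y hy i => by
    rw [← ofReal_norm]
    exact ENNReal.ofReal_le_ofReal ((PiLp.norm_apply_le y i).trans (hM' y hy))
  have hfin : ∫⁻ x, f x ≠ ⊤ := by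
    have : ∫⁻ x, f x = μ univ := by rw [hμf, withDensity_apply _ MeasurableSet.univ]; simp
    rw [this]
    exact measure_ne_top _ _
  obtain ⟨δ, hδ, hδf⟩ := exists_pos_setLIntegral_lt_of_measure_lt hfin ha2.ne'
  set S : ℕ → Fin d → Set 𝔼 := fun n i => ball x r ∩ {y | ‖U n i y‖ₑ ≤ M} with hS
  have hSm : ∀ n i, MeasurableSet (S n i) := fun n i =>
    measurableSet_ball.inter (measurableSet_le ((hU n i).1.measurable.enorm) measurable_const)
  have hSδ : ∀ n i, δ ≤ volume (S n i) := by
    intro n i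
    by_contra hlt
    have h1 : μ (S n i) < a / 2 := by
      rw [hμf, withDensity_apply _ (hSm n i)]
      exact hδf _ (not_le.1 hlt)
    have h2 : μ (T n ⁻¹' Kᶜ) ≤ a / 2 := by
      rw [← Measure.map_apply_of_aemeasurable (hT n) hK.isClosed.measurableSet.compl, hν n]
      exact hνK ν rfl
    have h3 : a ≤ μ (S n i ∪ T n ⁻¹' Kᶜ) := by
      refine measure_mono_ae ?_
      filter_upwards [hμ.ae_le (hU n i).2] with y hy hyb
      by_cases hyK : T n y ∈ K
      · refine Or.inl ⟨hyb, ?_⟩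
        change ‖U n i y‖ₑ ≤ M
        rw [← hy]
        exact hM _ hyK i
      · exact Or.inr hyK
    have h4 : a < a / 2 + a / 2 := (h3.trans (measure_union_le _ _)).trans_lt
      (ENNReal.add_lt_add_of_lt_of_le (ne_top_of_le_ne_top (ENNReal.div_ne_top hatop (by simp)) h2)
        h1 h2)
    rw [ENNReal.add_halves] at h4
    exact lt_irrefl _ h4
  set P : ℝ≥0∞ := 2 * (M ^ 2 * volume (ball x r) * volume (ball x r) +
    volume (ball (0 : 𝔼) (2 * r)) * (ENNReal.ofReal (2 * r) ^ 2 * D)) with hP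
  have hPtop : P ≠ ⊤ := by
    have h1 : volume (ball x r) ≠ ⊤ := measure_ball_lt_top.ne
    have h2 : volume (ball (0 : 𝔼) (2 * r)) ≠ ⊤ := measure_ball_lt_top.ne
    finiteness
  refine ⟨ball x r, ball_mem_nhds x hr, (P / δ).toNNReal, fun k => ?_⟩
  rw [ENNReal.coe_toNNReal (ENNReal.div_ne_top hPtop hδ.ne'), inter_eq_self_of_subset_left hball,
    ENNReal.le_div_iff_mul_le (Or.inl hδ.ne') (Or.inr hPtop), mul_comm]
  have h := (hU k.1 k.2).1.mul_lintegral_ball_sq_le hΩ hb hball (hSm k.1 k.2) inter_subset_left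
    (M := M) fun y hy => hy.2
  refine (mul_le_mul_left (hSδ k.1 k.2) _).trans (h.trans ?_)
  rw [hP]
  gcongr
  exact hD _ _

/-! ### Compactness of the set of admissible maps -/

theorem gradEnergy_ne_top {Ω : Set 𝔼} {u : 𝔼 → ℝ} {g : Fin d → 𝔼 → ℝ}
    (hu : IsSobolevPair Ω u g) : gradEnergy g ≠ ⊤ := by
  rw [gradEnergy_eq_sum hu.measurable_grad]
  refine ENNReal.sum_ne_top.2 fun j _ => ?_
  rw [lintegral_enorm_sq_eq_ofReal (hu.memLp_grad j)]
  exact ENNReal.ofReal_ne_top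

theorem lintegral_sub_sq_le_two_mul {u v : 𝔼 → ℝ} (hu : Measurable u) :
    ∫⁻ x, ‖(u - v) x‖ₑ ^ 2 ≤ 2 * ((∫⁻ x, ‖u x‖ₑ ^ 2) + ∫⁻ x, ‖v x‖ₑ ^ 2) := by
  rw [← lintegral_add_left (hu.enorm.pow_const 2), ← lintegral_const_mul' _ _ (by finiteness)]
  refine lintegral_mono fun x => (enorm_sq_le_two_mul _ (u x)).trans_eq ?_
  simp

theorem tendsto_of_tendsto_enorm_sub_sq {a : ℕ → ℝ} {b : ℝ}
    (h : Filter.Tendsto (fun n => ‖a n - b‖ₑ ^ 2) Filter.atTop (𝓝 0)) :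
    Filter.Tendsto a Filter.atTop (𝓝 b) := by
  refine tendsto_iff_edist_tendsto_0.2 (ENNReal.tendsto_nhds_zero.2 fun ε hε => ?_)
  filter_upwards [ENNReal.tendsto_nhds_zero.1 h (ε ^ 2) (ENNReal.pow_pos hε 2)] with n hn
  rw [edist_eq_enorm_sub]
  by_contra hlt
  exact absurd (ENNReal.pow_lt_pow_left two_ne_zero (not_le.1 hlt)) (not_lt.2 hn)

/-- A sequence of Sobolev maps bounded in `H¹(Ω)` has a subsequence which converges almost
everywhere on `Ω` and whose weak gradients converge weakly. -/
theorem exists_subseq_ae_tendsto_of_bounded {Ω : Set 𝔼} (hΩ : IsOpen Ω)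
    (hb : Bornology.IsBounded Ω) {V : ℕ → Fin d → 𝔼 → ℝ} {h : ℕ → Fin d → Fin d → 𝔼 → ℝ}
    (hV : ∀ n i, IsSobolevPair Ω (V n i) (h n i)) {C D : ℝ≥0}
    (hC : ∀ n i, ∫⁻ x, ‖V n i x‖ₑ ^ 2 ≤ C) (hD : ∀ n i, gradEnergy (h n i) ≤ D) :
    ∃ (v : Fin d → 𝔼 → ℝ) (w : Fin d → Fin d → 𝔼 → ℝ) (φ : ℕ → ℕ), StrictMono φ ∧
      (∀ i, IsSobolevPair Ω (v i) (w i)) ∧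
      (∀ i, gradEnergy (w i) ≤ Filter.liminf (fun n => gradEnergy (h (φ n) i)) Filter.atTop) ∧
      ∀ᵐ x, x ∈ Ω → ∀ i, Filter.Tendsto (fun n => V (φ n) i x) Filter.atTop (𝓝 (v i x)) := by
  -- the functions and their partial derivatives are treated as one finite family of sequences
  let F : Fin d × Option (Fin d) → ℕ → 𝔼 → ℝ := fun k n => k.2.elim (V n k.1) (h n k.1)
  have hF2 : ∀ k n, MemLp (F k n) 2 volume := by
    rintro ⟨i, _ | j⟩ n
    · exact (hV n i).memLp
    · exact (hV n i).memLp_grad j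
  have hF0 : ∀ k n, ∀ x ∉ Ω, F k n x = 0 := by
    rintro ⟨i, _ | j⟩ n
    · exact (hV n i).eq_zero
    · exact (hV n i).grad_eq_zero j
  have hFC : ∀ k n, ∫⁻ x, ‖F k n x‖ₑ ^ 2 ≤ (C + D : ℝ≥0) := by
    rintro ⟨i, _ | j⟩ n
    · exact (hC n i).trans (by simp)
    · refine le_trans ?_ ((hD n i).trans (by simp))
      exact lintegral_mono fun x =>
        Finset.single_le_sum (f := fun j => ‖h n i j x‖ₑ ^ 2) (fun _ _ => zero_le)
          (Finset.mem_univ j)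
  obtain ⟨L, φ, hφ, hLm, hL0, hL2, hlim⟩ :=
    exists_subseq_forall_weakTendsto hΩ.measurableSet hF2 hF0 hFC
  have hv : ∀ i, IsSobolevPair Ω (L (i, none)) (fun j => L (i, some j)) := fun i =>
    IsSobolevPair.of_weakTendsto (fun n => hV (φ n) i) (hLm _) (fun j => hLm _) (hL0 _)
      (fun j => hL0 _) (hL2 _) (fun j => hL2 _) (hlim (i, none)) fun j => hlim (i, some j)
  have hstrong : ∀ i, ∀ K, IsCompact K → K ⊆ Ω → Filter.Tendsto
      (fun n => ∫⁻ x in K, ‖(V (φ n) i - L (i, none)) x‖ₑ ^ 2) Filter.atTop (𝓝 0) := by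
    intro i K hK hKΩ
    have hnull : WeakTendsto (fun n => V (φ n) i - L (i, none)) 0 := by
      intro ψ hψ
      have h1 := (hlim (i, none) ψ hψ).sub_const (∫ x, L (i, none) x * ψ x)
      simp only [sub_self] at h1
      simp only [Pi.zero_apply, zero_mul, integral_zero]
      refine h1.congr fun n => ?_
      have i1 : Integrable fun x => V (φ n) i x * ψ x := (hV (φ n) i).memLp.integrable_mul hψ
      have i2 : Integrable fun x => L (i, none) x * ψ x := (hL2 _).integrable_mul hψ
      change (∫ x, V (φ n) i x * ψ x) - _ = _
      rw [← integral_sub i1 i2]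
      simp only [Pi.sub_apply, sub_mul]
    have hLtop : ∫⁻ x, ‖L (i, none) x‖ₑ ^ 2 ≠ ⊤ := by
      rw [lintegral_enorm_sq_eq_ofReal (hL2 _)]
      exact ENNReal.ofReal_ne_top
    have hgtop := gradEnergy_ne_top (hv i)
    refine hnull.tendsto_lintegral_sq hΩ hb (fun n => (hV (φ n) i).sub hb (hv i))
      (C := 2 * (C + (∫⁻ x, ‖L (i, none) x‖ₑ ^ 2).toNNReal))
      (D := 2 * (D + (gradEnergy fun j => L (i, some j)).toNNReal)) (fun n => ?_) (fun n => ?_)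
      hK hKΩ
    · push_cast
      rw [ENNReal.coe_toNNReal hLtop]
      refine (lintegral_sub_sq_le_two_mul (hV (φ n) i).measurable).trans ?_
      gcongr
      exact hC _ i
    · push_cast
      rw [ENNReal.coe_toNNReal hgtop]
      refine (gradEnergy_sub_le (hV (φ n) i).measurable_grad).trans ?_
      gcongr
      exact hD _ i
  have hmeas : ∀ n i, Measurable fun x => ‖(V (φ n) i - L (i, none)) x‖ₑ ^ 2 := fun n i =>
    (((hV (φ n) i).measurable.sub (hLm _)).enorm.pow_const 2)
  obtain ⟨χ, hχ, hae⟩ := exists_subseq_ae_tendsto_zero hΩ hb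
    (s := fun n x => ∑ i, ‖(V (φ n) i - L (i, none)) x‖ₑ ^ 2)
    (fun n => Finset.measurable_sum _ fun i _ => hmeas n i) fun K hK hKΩ => by
      simp_rw [lintegral_finsetSum _ fun i _ => hmeas _ i]
      simpa using tendsto_finsetSum Finset.univ fun i _ => hstrong i K hK hKΩ
  refine ⟨fun i => L (i, none), fun i j => L (i, some j), φ ∘ χ, hφ.comp hχ, hv, fun i => ?_, ?_⟩
  · exact gradEnergy_le_liminf (fun n => hV (φ (χ n)) i) (hv i)
      fun j => (hlim (i, some j)).comp hχ
  · filter_upwards [hae] with x hx hxΩ i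
    refine tendsto_of_tendsto_enorm_sub_sq ?_
    refine tendsto_of_tendsto_of_tendsto_of_le_of_le tendsto_const_nhds (hx hxΩ)
      (fun n => zero_le) fun n => ?_
    exact Finset.single_le_sum (f := fun i => ‖(V (φ (χ n)) i - L (i, none)) x‖ₑ ^ 2)
      (fun _ _ => zero_le) (Finset.mem_univ i)

/-- Compactness of the admissible maps with bounded Dirichlet energy. The maps are first set to
zero on the components of `Ω` which `μ` does not charge, the only ones on which the sequence may
fail to be bounded. -/
theorem exists_subseq_tendsto_sobolevTransportMaps {Ω : Set 𝔼} (hΩ : IsOpen Ω)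
    (hb : Bornology.IsBounded Ω) (hlip : HasLipschitzBoundary Ω) {μ ν : Measure 𝔼}
    [IsProbabilityMeasure μ] [IsProbabilityMeasure ν] (hμΩ : μ Ωᶜ = 0) {f : 𝔼 → ℝ≥0∞}
    (hμf : μ = volume.withDensity f) {T : ℕ → 𝔼 → 𝔼} (hT : ∀ n, T n ∈ sobolevTransportMaps Ω μ ν)
    {D : ℝ≥0} (hD : ∀ n, dirichletEnergy Ω (T n) ≤ D) :
    ∃ S ∈ sobolevTransportMaps Ω μ ν, ∃ φ : ℕ → ℕ, StrictMono φ ∧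
      (∀ᵐ x ∂μ, Filter.Tendsto (fun n => T (φ n) x) Filter.atTop (𝓝 (S x))) ∧
      dirichletEnergy Ω S ≤
        Filter.liminf (fun n => dirichletEnergy Ω (T (φ n))) Filter.atTop := by
  have hμ : μ ≪ volume.restrict Ω := absolutelyContinuous_restrict hμΩ
    (hμf ▸ withDensity_absolutelyContinuous _ _)
  have hTm : ∀ n, AEMeasurable (T n) μ := fun n => (hT n).1.1.1.aemeasurable.mono_ac hμ
  choose U g hU using fun n => (hT n).1.exists_representsOn hΩ
  have hE := fun n => (hU n).dirichletEnergy_eq hΩ hb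
  have hgD : ∀ n i, gradEnergy (g n i) ≤ D := fun n i =>
    (Finset.single_le_sum (f := fun i => gradEnergy (g n i)) (fun _ _ => zero_le)
      (Finset.mem_univ i)).trans ((hE n).symm.trans_le (hD n))
  set u : ℕ × Fin d → 𝔼 → ℝ := fun k => U k.1 k.2 with hu_def
  set G : Set 𝔼 := {x ∈ Ω | IsLocallyL2BoundedAt Ω u x} with hG_def
  have hG : IsOpen G := hΩ.inter (isOpen_setOf_isLocallyL2BoundedAt Ω u)
  have hG' : IsOpen (Ω \ G) := by
    have : Ω \ G = {x ∈ Ω | ¬ IsLocallyL2BoundedAt Ω u x} := by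
      ext x
      constructor
      · exact fun hx => ⟨hx.1, fun h => hx.2 ⟨hx.1, h⟩⟩
      · exact fun hx => ⟨hx.1, fun h => hx.2 h.2⟩
    rw [this]
    exact isOpen_setOf_not_isLocallyL2BoundedAt (g := fun k => g k.1 k.2) hΩ hb
      (fun k => (hU k.1 k.2).1) (fun k => hgD k.1 k.2)
  have hμG : μ (Ω \ G) = 0 := by
    refine measure_null_of_locally_null _ fun x hx => ?_
    obtain ⟨r, hr, hball⟩ := Metric.isOpen_iff.1 hΩ x hx.1
    refine ⟨ball x r, mem_nhdsWithin_of_mem_nhds (ball_mem_nhds x hr), ?_⟩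
    by_contra h0
    exact hx.2 ⟨hx.1, isLocallyL2BoundedAt_of_measure_ball_ne_zero hΩ hb hμf hμ hTm
      (fun n => (hT n).2) hU hgD hr hball h0⟩
  have hV : ∀ k : ℕ × Fin d,
      IsSobolevPair Ω (G.indicator (u k)) (fun j => G.indicator (g k.1 k.2 j)) :=
    fun k => (hU k.1 k.2).1.indicator hG hG'
  have hVD : ∀ k : ℕ × Fin d, gradEnergy (fun j => G.indicator (g k.1 k.2 j)) ≤ D :=
    fun k => (gradEnergy_indicator_le _ _).trans (hgD k.1 k.2)
  have hgood : ∀ x ∈ Ω, IsLocallyL2BoundedAt Ω (fun k => G.indicator (u k)) x := by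
    intro x hx
    by_cases hxG : x ∈ G
    · obtain ⟨W, hW, C, hC⟩ := hxG.2
      refine ⟨W, hW, C, fun k => (lintegral_mono fun y => ?_).trans (hC k)⟩
      gcongr
      exact enorm_indicator_le_enorm_self _ _
    · refine ⟨Ω \ G, hG'.mem_nhds ⟨hx, hxG⟩, 0, fun k => ?_⟩
      rw [setLIntegral_congr_fun (g := fun _ => 0) (hG'.inter hΩ).measurableSet fun y hy => by
        simp [indicator_of_notMem hy.1.2]]
      simp
  obtain ⟨C, hC⟩ := exists_bound_of_hasLipschitzBoundary hΩ hb hlip hV hVD hgood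
  obtain ⟨v, w, φ, hφ, hv, hw, hlim⟩ := exists_subseq_ae_tendsto_of_bounded hΩ hb
    (V := fun n i => G.indicator (u (n, i))) (h := fun n i j => G.indicator (g n i j))
    (fun n i => hV (n, i)) (fun n i => hC (n, i)) (fun n i => hVD (n, i))
  set S : 𝔼 → 𝔼 := fun x => WithLp.toLp 2 fun i => v i x with hS
  have hSrep : RepresentsOn Ω S v w := fun i => ⟨hv i, Filter.EventuallyEq.rfl⟩
  have hUae : ∀ᵐ x ∂μ, ∀ n i, T n x i = U n i x :=
    hμ.ae_le (ae_all_iff.2 fun n => ae_all_iff.2 fun i => (hU n i).2)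
  have hGae : ∀ᵐ x ∂μ, x ∈ G := by
    refine mem_ae_iff.2 (measure_mono_null (t := Ωᶜ ∪ Ω \ G) (fun x hx => ?_)
      (measure_union_null hμΩ hμG))
    by_cases hxΩ : x ∈ Ω
    · exact Or.inr ⟨hxΩ, hx⟩
    · exact Or.inl hxΩ
  have hTS : ∀ᵐ x ∂μ, Filter.Tendsto (fun n => T (φ n) x) Filter.atTop (𝓝 (S x)) := by
    have hlim' : ∀ᵐ x ∂μ, x ∈ Ω → ∀ i, Filter.Tendsto
        (fun n => G.indicator (u (φ n, i)) x) Filter.atTop (𝓝 (v i x)) :=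
      (hμ.trans Measure.absolutelyContinuous_restrict).ae_le hlim
    filter_upwards [hUae, hGae, hlim'] with x h1 h2 h3
    have h4 : Filter.Tendsto (fun n => (fun i => T (φ n) x i)) Filter.atTop
        (𝓝 fun i => v i x) := by
      refine tendsto_pi_nhds.2 fun i => (h3 h2.1 i).congr fun n => ?_
      rw [indicator_of_mem h2, h1]
    exact ((PiLp.continuous_toLp 2 _).tendsto _).comp h4
  refine ⟨S, ⟨hSrep.memH1 hb, map_eq_of_ae_tendsto (fun n => hTm (φ n)) (fun n => (hT (φ n)).2) hTS⟩,
    φ, hφ, hTS, ?_⟩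
  rw [hSrep.dirichletEnergy_eq hΩ hb]
  refine (Finset.sum_le_sum fun i _ => hw i).trans ((sum_liminf_le_liminf_sum _).trans ?_)
  refine Filter.liminf_le_liminf (Filter.Eventually.of_forall fun n => ?_)
  simp only [hE]
  exact Finset.sum_le_sum fun i _ => gradEnergy_indicator_le _ _

/-! ### Existence of a minimizer -/

theorem lintegral_mul_density_eq {Ω : Set 𝔼} (hΩ : MeasurableSet Ω) {μ : Measure 𝔼}
    (hμΩ : μ Ωᶜ = 0) {f : 𝔼 → ℝ≥0∞} (hf : Measurable f) (hμf : μ = volume.withDensity f)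
    {c : 𝔼 → ℝ≥0∞} (hc : AEMeasurable c (volume.restrict Ω)) :
    ∫⁻ x in Ω, c x * f x = ∫⁻ x, c x ∂μ := by
  have h1 : μ = (volume.restrict Ω).withDensity f := by
    rw [← restrict_withDensity hΩ, ← hμf]
    exact (Measure.restrict_eq_self_of_ae_mem (mem_ae_iff.2 hμΩ)).symm
  rw [h1, lintegral_withDensity_eq_lintegral_mul₀ hf.aemeasurable hc]
  exact lintegral_congr fun x => mul_comm _ _

/-- Lower semicontinuity of the transport cost under almost everywhere convergence. -/
theorem lintegral_transport_le_liminf {μ : Measure 𝔼} {T : ℕ → 𝔼 → 𝔼} {S : 𝔼 → 𝔼}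
    (hT : ∀ n, AEMeasurable (T n) μ)
    (hlim : ∀ᵐ x ∂μ, Filter.Tendsto (fun n => T n x) Filter.atTop (𝓝 (S x))) :
    ∫⁻ x, ENNReal.ofReal ‖S x - x‖ ∂μ ≤
      Filter.liminf (fun n => ∫⁻ x, ENNReal.ofReal ‖T n x - x‖ ∂μ) Filter.atTop := by
  refine le_trans (lintegral_mono_ae ?_) (lintegral_liminf_le' fun n =>
    ((hT n).sub aemeasurable_id).norm.ennreal_ofReal)
  filter_upwards [hlim] with x hx
  exact (ENNReal.tendsto_ofReal (hx.sub_const x).norm).liminf_eq.ge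

theorem mainTheorem9 {d : ℕ} (Ω : Set (EuclideanSpace ℝ (Fin d)))
    (hΩ_open : IsOpen Ω) (hΩ_bdd : Bornology.IsBounded Ω) (hΩ_lip : HasLipschitzBoundary Ω)
    (μ ν : Measure (EuclideanSpace ℝ (Fin d))) [IsProbabilityMeasure μ] [IsProbabilityMeasure ν]
    (hμΩ : μ Ωᶜ = 0)
    (f : EuclideanSpace ℝ (Fin d) → ℝ≥0∞) (hf : Measurable f) (hμf : μ = volume.withDensity f)
    (hne : (sobolevTransportMaps Ω μ ν).Nonempty)
    (ε : ℝ) (hε : 0 < ε) :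
    ∃ T ∈ sobolevTransportMaps Ω μ ν,
      penalizedCost Ω f ε T = ⨅ S ∈ sobolevTransportMaps Ω μ ν, penalizedCost Ω f ε S := by
  set I := ⨅ S ∈ sobolevTransportMaps Ω μ ν, penalizedCost Ω f ε S with hI
  have hIle : ∀ S ∈ sobolevTransportMaps Ω μ ν, I ≤ penalizedCost Ω f ε S := fun S hS =>
    iInf₂_le S hS
  -- if no admissible map has finite cost, each of them is a minimizer
  by_cases hItop : I = ⊤
  · obtain ⟨T, hT⟩ := hne
    exact ⟨T, hT, le_antisymm (hItop ▸ le_top) (hIle T hT)⟩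
  have hε0 : ENNReal.ofReal ε ≠ 0 := (ENNReal.ofReal_pos.2 hε).ne'
  have hμ : μ ≪ volume.restrict Ω := absolutelyContinuous_restrict hμΩ
    (hμf ▸ withDensity_absolutelyContinuous _ _)
  -- a minimizing sequence
  have hmin : ∀ n : ℕ, ∃ T ∈ sobolevTransportMaps Ω μ ν,
      penalizedCost Ω f ε T < I + ((n : ℝ≥0∞) + 1)⁻¹ := fun n => by
    have h1 : I < I + ((n : ℝ≥0∞) + 1)⁻¹ :=
      ENNReal.lt_add_right hItop (ENNReal.inv_ne_zero.2 (by finiteness))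
    conv_lhs at h1 => rw [hI]
    simpa only [iInf_lt_iff, exists_prop] using h1
  choose T hT hTI using hmin
  have hTm : ∀ n, AEMeasurable (T n) (volume.restrict Ω) := fun n => (hT n).1.1.1.aemeasurable
  have hcost : ∀ {S}, S ∈ sobolevTransportMaps Ω μ ν → penalizedCost Ω f ε S =
      (∫⁻ x, ENNReal.ofReal ‖S x - x‖ ∂μ) + ENNReal.ofReal ε * dirichletEnergy Ω S :=
    fun {S} hS => by
      rw [penalizedCost, lintegral_mul_density_eq hΩ_open.measurableSet hμΩ hf hμf]
      exact (hS.1.1.1.aemeasurable.sub aemeasurable_id).norm.ennreal_ofReal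
  have hDtop : (I + 1) / ENNReal.ofReal ε ≠ ⊤ := ENNReal.div_ne_top (by finiteness) hε0
  have hD : ∀ n, dirichletEnergy Ω (T n) ≤ ((I + 1) / ENNReal.ofReal ε).toNNReal := fun n => by
    rw [ENNReal.coe_toNNReal hDtop, ENNReal.le_div_iff_mul_le (Or.inl hε0)
      (Or.inl ENNReal.ofReal_ne_top), mul_comm]
    calc ENNReal.ofReal ε * dirichletEnergy Ω (T n) ≤ penalizedCost Ω f ε (T n) := le_add_self
      _ ≤ I + ((n : ℝ≥0∞) + 1)⁻¹ := (hTI n).le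
      _ ≤ I + 1 := by gcongr; simp
  obtain ⟨S, hS, φ, hφ, hTS, hDS⟩ := exists_subseq_tendsto_sobolevTransportMaps hΩ_open hΩ_bdd
    hΩ_lip hμΩ hμf hT hD
  refine ⟨S, hS, le_antisymm ?_ (hIle S hS)⟩
  have hlimI : Filter.Tendsto (fun n : ℕ => I + ((n : ℝ≥0∞) + 1)⁻¹) Filter.atTop (𝓝 I) := by
    have h1 : Filter.Tendsto (fun n : ℕ => ((n : ℝ≥0∞) + 1)⁻¹) Filter.atTop (𝓝 0) := by
      simpa using (Filter.tendsto_add_atTop_iff_nat 1).2 ENNReal.tendsto_inv_nat_nhds_zero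
    simpa using h1.const_add I
  calc penalizedCost Ω f ε S
      = (∫⁻ x, ENNReal.ofReal ‖S x - x‖ ∂μ) + ENNReal.ofReal ε * dirichletEnergy Ω S := hcost hS
    _ ≤ Filter.liminf (fun n => ∫⁻ x, ENNReal.ofReal ‖T (φ n) x - x‖ ∂μ) Filter.atTop +
          Filter.liminf (fun n => ENNReal.ofReal ε * dirichletEnergy Ω (T (φ n))) Filter.atTop := by
        refine add_le_add (lintegral_transport_le_liminf (fun n => (hTm _).mono_ac hμ) hTS) ?_
        rw [ENNReal.liminf_const_mul_of_ne_top ENNReal.ofReal_ne_top]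
        gcongr
    _ ≤ Filter.liminf (fun n => penalizedCost Ω f ε (T (φ n))) Filter.atTop := by
        simp only [hcost (hT _)]
        exact liminf_add_liminf_le _ _
    _ ≤ Filter.liminf (fun n => I + ((φ n : ℝ≥0∞) + 1)⁻¹) Filter.atTop :=
        Filter.liminf_le_liminf (Filter.Eventually.of_forall fun n => (hTI _).le)
    _ = I := (hlimI.comp hφ.tendsto_atTop).liminf_eq
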